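/- **Conventions.** A directed graph $E=(E^0,E^1,r,s)$ consists of countable sets $E^0$ (vertices) and $E^1$ (edges) and maps $r,s\colon E^1\to E^0$. It is row-finite if $r^{-1}(v)$ is finite for every $v\in E^0$, and $v$ is a source if $r^{-1}(v)=\varnothing$. Finite paths are $\mu=e_1\cdots e_n$ with $s(e_i)=r(e_{i+1})$, together with the vertices (paths of length $0$); $r(\mu)=r(e_1)$ and $s(\mu)=s(e_n)$. For a row-finite graph $E$, a Cuntz–Krieger $E$-family consists of mutually orthogonal projections $P_v$ ($v\in E^0$) and partial isometries $S_e$ ($e\in E^1$) with mutually orthogonal ranges such that $S_e^*S_e=P_{s(e)}$ for all $e\in E^1$, and $P_v=\sum_{r(e)=v}S_eS_e^*$ for every $v$ that is not a source. $C^*(E)$ is the universal C*-algebra generated by a Cuntz–Krieger $E$-family $\{s_e,p_v\}$. Its canonical gauge action $\gamma^E$ is the action of the circle $\mathbb T$ with $\gamma^E_z(s_e)=zs_e$ and $\gamma^E_z(p_v)=p_v$. Its diagonal $\mathcal D(E)$ is the C*-subalgebra generated by the projections $s_\mu s_\mu^*$, where $\mu$ runs through all finite paths and $s_\mu=s_{e_1}\cdots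 s_{e_n}$, $s_v=p_v$. Actions of $\mathbb T$ on C*-algebras are strongly continuous and by *-automorphisms. Row-finite graphs $E_1,E_2$ are elementary strong shift equivalent via a row-finite graph $E_3$ if: * $E_3^0=E_1^0\sqcup E_2^0$ (disjoint union); * every edge of $E_3$ either has source in $E_1^0$ and range in $E_2^0$, or has source in $E_2^0$ and range in $E_1^0$; * for $i=1,2$ there is a source- and range-preserving bijection from $E_i^1$ onto the set of paths of length $2$ in $E_3$ with source and range in $E_i^0$; * if $v\in E_3^0$ is a source in $E_3$, then there is $\eta\in E_3^1$ with $s_3^{-1}(v)=\{\eta\}$ and $r_3^{-1}(r_3(\eta))=\{\eta\}$. A projection $P$ in the multiplier algebra $M(C)$ of a C*-algebra $C$ is full if the linear span of $CPC$ is dense in $C$; projections $P_1,P_2\in M(C)$ are complementary if $P_1+P_2=1$. Triples $(A_1,\alpha_1,D_1)$ and $(A_2,\alpha_2,D_2)$, each consisting of a C*-algebra, an action of $\mathbb T$ on it and a subalgebra, are Morita equivalent if there are a C*-algebra $C$ with an action $\gamma$ of $\mathbb T$ and a C*-subalgebra $\mathcal D(C)$, complementary full projections $P_1,P_2\in M(C)$,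 and *-isomorphisms $\pi_i\colon A_i\to P_iCP_i$ such that $\pi_i\circ\alpha_{i,z}=\gamma_z\circ\pi_i$ for all $z\in\mathbb T$ and $\pi_i(D_i)=P_i\mathcal D(C)$, for $i=1,2$. **Theorem.** Let $E_1$ and $E_2$ be row-finite graphs, possibly with sinks and sources, that are elementary strong shift equivalent via $E_3$, and let $r_v$ ($v\in E_3^0$) be the canonical vertex projections of $C^*(E_3)$. Then the sums $$P_1=\sum_{v\in E_1^0}r_v,\qquad P_2=\sum_{v\in E_2^0}r_v$$ converge strictly to complementary full projections in $M(C^*(E_3))$, and there are an action $\alpha$ of $\mathbb T$ on $C^*(E_3)$ and *-isomorphisms $\pi_i\colon C^*(E_i)\to P_iC^*(E_3)P_i$ ($i=1,2$) such that $$\pi_i\circ\gamma^{E_i}_z=\alpha_z\circ\pi_i\quad(z\in\mathbb T),\qquad \pi_i(\mathcal D(E_i))=P_i\,\mathcal D(E_3)\,P_i .$$ In particular, the triples $(C^*(E_1),\gamma^{E_1},\mathcal D(E_1))$ and $(C^*(E_2),\gamma^{E_2},\mathcal D(E_2))$ are Morita equivalent. -/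

import Mathlib

open scoped ENNReal MultiplierAlgebra

universe u v w

noncomputable section

/-! ### Directed graphs -/

/-- A directed graph: countable sets of vertices and edges with range and source maps. -/
structure DirectedGraph where
  Vertex : Type u
  Edge : Type u
  r : Edge → Vertex
  s : Edge → Vertex
  [countable_vertex : Countable Vertex]
  [countable_edge : Countable Edge]

namespace DirectedGraph

attribute [instance] DirectedGraph.countable_vertex DirectedGraph.countable_edge

/-- A vertex is a source if it receives no edge. -/
def IsSource (E : DirectedGraph.{u}) (v : E.Vertex) : Prop :=
  {e : E.Edge | E.r e = v} = ∅

/-- A graph is row-finite if every vertex receives only finitely many edges. -/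
class RowFinite (E : DirectedGraph.{u}) : Prop where
  finite_edgesInto : ∀ v : E.Vertex, {e : E.Edge | E.r e = v}.Finite

/-- The finite set `r⁻¹(v)`. -/
def edgesInto (E : DirectedGraph.{u}) [E.RowFinite] (v : E.Vertex) : Finset E.Edge :=
  (RowFinite.finite_edgesInto v).toFinset

/-- `E.FinPath v w` is the type of finite paths `e₁ ⋯ eₙ` with `s(eᵢ) = r(eᵢ₊₁)`, with range
`v = r(e₁)` and source `w = s(eₙ)`; the vertices are the paths of length zero. -/
inductive FinPath (E : DirectedGraph.{u}) : E.Vertex → E.Vertex → Type u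
  | vertex (v : E.Vertex) : FinPath E v v
  | cons (e : E.Edge) {w : E.Vertex} (μ : FinPath E (E.s e) w) : FinPath E (E.r e) w

/-- The set `E²(A, B)` of paths `η₂ η₁` of length two with source in `A` and range in `B`;
such a path is the pair `(η₂, η₁)` with `s(η₂) = r(η₁)`. -/
def TwoPath (E : DirectedGraph.{u}) (A B : Set E.Vertex) : Type u :=
  {q : E.Edge × E.Edge // E.s q.1 = E.r q.2 ∧ E.s q.2 ∈ A ∧ E.r q.1 ∈ B}

/-- `E₁` and `E₂` are elementary strong shift equivalent via `E₃`. The inclusions of `E₁⁰` and `E₂⁰`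
in `E₃⁰` are written as injections `ι₁`, `ι₂` with disjoint ranges that cover `E₃⁰`. -/
structure ElementarySSE (E₁ E₂ E₃ : DirectedGraph.{u}) where
  ι₁ : E₁.Vertex → E₃.Vertex
  ι₂ : E₂.Vertex → E₃.Vertex
  ι₁_injective : Function.Injective ι₁
  ι₂_injective : Function.Injective ι₂
  vertex_union : Set.range ι₁ ∪ Set.range ι₂ = Set.univ
  vertex_disjoint : Disjoint (Set.range ι₁) (Set.range ι₂)
  /-- Every edge goes from `E₁⁰` to `E₂⁰` or from `E₂⁰` to `E₁⁰`. -/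
  edge_bipartite : ∀ η : E₃.Edge,
    (E₃.s η ∈ Set.range ι₁ ∧ E₃.r η ∈ Set.range ι₂) ∨
    (E₃.s η ∈ Set.range ι₂ ∧ E₃.r η ∈ Set.range ι₁)
  θ₁ : E₁.Edge ≃ E₃.TwoPath (Set.range ι₁) (Set.range ι₁)
  θ₁_range : ∀ e, E₃.r (θ₁ e).1.1 = ι₁ (E₁.r e)
  θ₁_source : ∀ e, E₃.s (θ₁ e).1.2 = ι₁ (E₁.s e)
  θ₂ : E₂.Edge ≃ E₃.TwoPath (Set.range ι₂) (Set.range ι₂)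
  θ₂_range : ∀ e, E₃.r (θ₂ e).1.1 = ι₂ (E₂.r e)
  θ₂_source : ∀ e, E₃.s (θ₂ e).1.2 = ι₂ (E₂.s e)
  source_condition : ∀ v : E₃.Vertex, E₃.IsSource v → ∃ η : E₃.Edge,
    {ξ : E₃.Edge | E₃.s ξ = v} = {η} ∧ {ξ : E₃.Edge | E₃.r ξ = E₃.r η} = {η}

end DirectedGraph

/-! ### Cuntz–Krieger families -/

/-- A Cuntz–Krieger `E`-family in a C⋆-algebra `B`: mutually orthogonal projections `P v` and partial
isometries `S e` with orthogonal ranges, satisfying the two Cuntz–Krieger relations. -/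
structure CuntzKriegerFamily (E : DirectedGraph.{u}) [E.RowFinite]
    (B : Type w) [NonUnitalCStarAlgebra B] where
  S : E.Edge → B
  P : E.Vertex → B
  isStarProjection_P : ∀ v, IsStarProjection (P v)
  orthogonal_P : ∀ v w, v ≠ w → P v * P w = 0
  partialIsometry_S : ∀ e, S e * star (S e) * S e = S e
  orthogonal_S : ∀ e f, e ≠ f → star (S e) * S f = 0
  ck1 : ∀ e, star (S e) * S e = P (E.s e)
  ck2 : ∀ v, ¬ E.IsSource v → P v = ∑ e ∈ E.edgesInto v, S e * star (S e)

namespace CuntzKriegerFamily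

variable {E : DirectedGraph.{u}} [E.RowFinite]
variable {B : Type v} [NonUnitalCStarAlgebra B] {C : Type w} [NonUnitalCStarAlgebra C]

/-- The elements of a family: edges and vertices together. -/
def gen (F : CuntzKriegerFamily E B) : E.Edge ⊕ E.Vertex → B :=
  Sum.elim F.S F.P

/-- The element `S_μ = S_{e₁} ⋯ S_{eₙ}` of a path, with `S_v = P_v` for a vertex. The last factor
`P_{s(eₙ)}` that this recursion adds is absorbed by `S_{eₙ}`. -/
def path (F : CuntzKriegerFamily E B) : {v w : E.Vertex} → E.FinPath v w → B
  | _, _, .vertex v => F.P v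
  | _, _, .cons e μ => F.S e * path F μ

lemma norm_P_le (F : CuntzKriegerFamily E B) (v : E.Vertex) : ‖F.P v‖ ≤ 1 :=
  (F.isStarProjection_P v).norm_le

lemma norm_S_le (F : CuntzKriegerFamily E B) (e : E.Edge) : ‖F.S e‖ ≤ 1 := by
  have h := CStarRing.norm_star_mul_self (x := F.S e)
  rw [F.ck1] at h
  have := F.norm_P_le (E.s e)
  nlinarith [norm_nonneg (F.S e)]

lemma norm_gen_le (F : CuntzKriegerFamily E B) (x : E.Edge ⊕ E.Vertex) : ‖F.gen x‖ ≤ 1 := by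
  cases x with
  | inl e => exact F.norm_S_le e
  | inr v => exact F.norm_P_le v

/-- The image of a family under a ⋆-homomorphism. -/
def map (F : CuntzKriegerFamily E B) (φ : B →⋆ₙₐ[ℂ] C) : CuntzKriegerFamily E C where
  S e := φ (F.S e)
  P v := φ (F.P v)
  isStarProjection_P v := (F.isStarProjection_P v).map φ
  orthogonal_P v w h := by rw [← map_mul, F.orthogonal_P v w h, map_zero]
  partialIsometry_S e := by rw [← map_star, ← map_mul, ← map_mul, F.partialIsometry_S]
  orthogonal_S e f h := by rw [← map_star, ← map_mul, F.orthogonal_S e f h, map_zero]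
  ck1 e := by rw [← map_star, ← map_mul, F.ck1]
  ck2 v h := by
    rw [F.ck2 v h, map_sum]
    simp only [map_mul, map_star]

/-- A family whose members all lie in a closed ⋆-subalgebra is a family in that subalgebra. -/
def codRestrict (F : CuntzKriegerFamily E B) (A : NonUnitalStarSubalgebra ℂ B)
    [IsClosed (A : Set B)] (h : ∀ x, F.gen x ∈ A) : CuntzKriegerFamily E A where
  S e := ⟨F.S e, h (.inl e)⟩
  P v := ⟨F.P v, h (.inr v)⟩
  isStarProjection_P v :=
    ⟨Subtype.ext (F.isStarProjection_P v).isIdempotentElem.eq,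
      Subtype.ext (F.isStarProjection_P v).isSelfAdjoint.star_eq⟩
  orthogonal_P v w h := Subtype.ext (F.orthogonal_P v w h)
  partialIsometry_S e := Subtype.ext (F.partialIsometry_S e)
  orthogonal_S e f h := Subtype.ext (F.orthogonal_S e f h)
  ck1 e := Subtype.ext (F.ck1 e)
  ck2 v h := Subtype.ext <| by
    rw [AddSubmonoidClass.coe_finsetSum]
    exact F.ck2 v h

/-- The family `{z S, P}` for `z` in the circle. -/
def rotate (z : Circle) (F : CuntzKriegerFamily E B) : CuntzKriegerFamily E B where
  S e := (z : ℂ) • F.S e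
  P v := F.P v
  isStarProjection_P := F.isStarProjection_P
  orthogonal_P := F.orthogonal_P
  partialIsometry_S e := by
    have hz : (z : ℂ) * star (z : ℂ) = 1 := by
      simp [Complex.mul_conj]
    simp only [star_smul, smul_mul_smul_comm, F.partialIsometry_S, hz, one_mul]
  orthogonal_S e f h := by
    simp only [star_smul, smul_mul_smul_comm, F.orthogonal_S e f h, smul_zero]
  ck1 e := by
    have hz : star (z : ℂ) * (z : ℂ) = 1 := by
      rw [mul_comm]; simp [Complex.mul_conj]
    simp only [star_smul, smul_mul_smul_comm, hz, one_smul, F.ck1]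
  ck2 v h := by
    have hz : (z : ℂ) * star (z : ℂ) = 1 := by
      simp [Complex.mul_conj]
    simp only [star_smul, smul_mul_smul_comm, hz, one_smul]
    exact F.ck2 v h

end CuntzKriegerFamily

/-! ### The graph C⋆-algebra -/

/-- All Cuntz–Krieger `E`-families in C⋆-algebras whose underlying set is small. Since `E` is
countable, every Cuntz–Krieger family generates a separable C⋆-algebra, so that none is missed up to
isomorphism: see `GraphCStarAlgebra.exists_lift`. -/
structure CKRepresentation (E : DirectedGraph.{u}) [E.RowFinite] where
  carrier : Type
  [str : NonUnitalCStarAlgebra carrier]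
  family : CuntzKriegerFamily E carrier

attribute [instance] CKRepresentation.str

/-- The bounded sections over all representations: the ℓ^∞-product of their C⋆-algebras. -/
abbrev CKProduct (E : DirectedGraph.{u}) [E.RowFinite] : Type (max 1 u) :=
  lp (fun R : CKRepresentation E => R.carrier) ∞

section product

variable (E : DirectedGraph.{u}) [E.RowFinite]

/-- An edge or vertex, as the section that picks its member in every family. -/
def CKProduct.gen (x : E.Edge ⊕ E.Vertex) : CKProduct E :=
  ⟨fun R => R.family.gen x, memℓp_infty ⟨1, by
    rintro _ ⟨R, rfl⟩
    exact R.family.norm_gen_le x⟩⟩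

/-- The evaluation of a section at a representation. -/
def CKProduct.eval (R : CKRepresentation E) : CKProduct E →⋆ₙₐ[ℂ] R.carrier where
  toFun x := x R
  map_smul' _ _ := rfl
  map_zero' := rfl
  map_add' _ _ := rfl
  map_mul' _ _ := rfl
  map_star' _ := rfl

/-- The family of all edge and vertex sections. -/
def CKProduct.family : CuntzKriegerFamily E (CKProduct E) where
  S e := CKProduct.gen E (.inl e)
  P v := CKProduct.gen E (.inr v)
  isStarProjection_P v :=
    ⟨lp.ext (funext fun R => (R.family.isStarProjection_P v).isIdempotentElem.eq),
      lp.ext (funext fun R => (R.family.isStarProjection_P v).isSelfAdjoint.star_eq)⟩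
  orthogonal_P v w h := lp.ext (funext fun R => R.family.orthogonal_P v w h)
  partialIsometry_S e := lp.ext (funext fun R => R.family.partialIsometry_S e)
  orthogonal_S e f h := lp.ext (funext fun R => R.family.orthogonal_S e f h)
  ck1 e := lp.ext (funext fun R => R.family.ck1 e)
  ck2 v h := lp.ext (funext fun R => by
    rw [lp.coeFn_sum, Finset.sum_apply]
    exact R.family.ck2 v h)

/-- The closed ⋆-subalgebra of the product generated by the edge and vertex sections. -/
def graphCStarSubalgebra : NonUnitalStarSubalgebra ℂ (CKProduct E) :=
  (NonUnitalStarAlgebra.adjoin ℂ (Set.range (CKProduct.gen E))).topologicalClosure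

instance : IsClosed (graphCStarSubalgebra E : Set (CKProduct E)) :=
  NonUnitalStarSubalgebra.isClosed_topologicalClosure _

end product

/-- The graph C⋆-algebra `C⋆(E)`, the universal C⋆-algebra of Cuntz–Krieger `E`-families. -/
def GraphCStarAlgebra (E : DirectedGraph.{u}) [E.RowFinite] : Type (max 1 u) :=
  graphCStarSubalgebra E

namespace GraphCStarAlgebra

variable (E : DirectedGraph.{u}) [E.RowFinite]

instance : NonUnitalCStarAlgebra (GraphCStarAlgebra E) :=
  inferInstanceAs (NonUnitalCStarAlgebra (graphCStarSubalgebra E))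

/-- The canonical (universal) Cuntz–Krieger family `{s, p}` of `C⋆(E)`. -/
def family : CuntzKriegerFamily E (GraphCStarAlgebra E) :=
  (CKProduct.family E).codRestrict (graphCStarSubalgebra E) (by
    intro x
    apply NonUnitalStarSubalgebra.le_topologicalClosure
    apply NonUnitalStarAlgebra.subset_adjoin
    refine ⟨x, ?_⟩
    cases x <;> rfl)

/-- The canonical vertex projection `p_v`. -/
abbrev p (v : E.Vertex) : GraphCStarAlgebra E := (family E).P v

/-- The canonical partial isometry `s_e`. -/
abbrev s (e : E.Edge) : GraphCStarAlgebra E := (family E).S e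

/-- `C⋆(E)` is generated by its canonical family. -/
theorem adjoin_family_dense :
    (NonUnitalStarAlgebra.adjoin ℂ (Set.range (family E).gen)).topologicalClosure = ⊤ := by
  rw [eq_top_iff]
  intro x _
  let ι : GraphCStarAlgebra E →⋆ₙₐ[ℂ] CKProduct E :=
    NonUnitalStarSubalgebraClass.subtype (graphCStarSubalgebra E)
  have hι : Topology.IsInducing ι := Topology.IsInducing.subtypeVal
  change x ∈ closure ((NonUnitalStarAlgebra.adjoin ℂ (Set.range (family E).gen) :
    NonUnitalStarSubalgebra ℂ (GraphCStarAlgebra E)) : Set (GraphCStarAlgebra E))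
  rw [hι.closure_eq_preimage_closure_image, Set.mem_preimage,
    ← NonUnitalStarSubalgebra.coe_map, NonUnitalStarAlgHom.map_adjoin, ← Set.range_comp]
  have h : (ι ∘ (family E).gen) = CKProduct.gen E := by
    funext y
    cases y <;> rfl
  rw [h]
  exact x.2

variable {E}

/-- Two ⋆-homomorphisms on `C⋆(E)` that agree on the canonical family are equal. -/
theorem hom_ext {B : Type w} [NonUnitalCStarAlgebra B] {φ ψ : GraphCStarAlgebra E →⋆ₙₐ[ℂ] B}
    (hs : ∀ e, φ (s E e) = ψ (s E e)) (hp : ∀ v, φ (p E v) = ψ (p E v)) : φ = ψ := by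
  have hφ : Continuous φ := AddMonoidHomClass.continuous_of_bound φ 1 (fun x => by
    simpa using NonUnitalStarAlgHom.norm_apply_le φ x)
  have hψ : Continuous ψ := AddMonoidHomClass.continuous_of_bound ψ 1 (fun x => by
    simpa using NonUnitalStarAlgHom.norm_apply_le ψ x)
  have h1 : (NonUnitalStarAlgebra.adjoin ℂ (Set.range (family E).gen)).topologicalClosure ≤
      NonUnitalStarAlgHom.equalizer φ ψ := by
    apply NonUnitalStarSubalgebra.topologicalClosure_minimal
    · apply NonUnitalStarAlgebra.adjoin_le
      rintro _ ⟨x, rfl⟩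
      cases x with
      | inl e => exact hs e
      | inr v => exact hp v
    · exact isClosed_eq hφ hψ
  ext x
  have : x ∈ (⊤ : NonUnitalStarSubalgebra ℂ (GraphCStarAlgebra E)) := trivial
  rw [← adjoin_family_dense] at this
  exact h1 this

end GraphCStarAlgebra

/-- The closed star subalgebra generated by a countable set is small. -/
theorem small_topologicalClosure_adjoin {B : Type w} [NonUnitalCStarAlgebra B] {T : Set B}
    (hT : T.Countable) :
    Small.{0} (NonUnitalStarAlgebra.adjoin ℂ T).topologicalClosure := by
  have hU : (T ∪ star T).Countable := hT.union (by
    rw [← Set.image_star]; exact hT.image _)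
  have hC : (Subsemigroup.closure (T ∪ star T) : Set B).Countable := by
    have : Countable (T ∪ star T : Set B) := hU.to_subtype
    let f : (T ∪ star T : Set B) × List (T ∪ star T : Set B) → B :=
      fun q => q.2.foldl (fun (a : B) (b : (T ∪ star T : Set B)) => a * (b : B)) q.1
    refine (Set.countable_range f).mono ?_
    intro x hx
    induction hx using Subsemigroup.closure_induction with
    | mem x hx => exact ⟨(⟨x, hx⟩, []), rfl⟩
    | mul x y hx' hy' hx hy =>
      obtain ⟨⟨a, l⟩, rfl⟩ := hx
      obtain ⟨⟨b, m⟩, rfl⟩ := hy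
      refine ⟨(a, l ++ b :: m), ?_⟩
      simp only [f, List.foldl_append, List.foldl_cons]
      clear hx' hy'
      generalize List.foldl (fun (a : B) (b : (T ∪ star T : Set B)) => a * (b : B)) (a : B) l = c
      generalize (b : B) = d
      induction m generalizing d with
      | nil => rfl
      | cons k m ih => simp only [List.foldl_cons]; rw [mul_assoc, ih]
  have hS : TopologicalSpace.IsSeparable
      (closure ((NonUnitalStarAlgebra.adjoin ℂ T : NonUnitalStarSubalgebra ℂ B) : Set B)) := by
    have h := (TopologicalSpace.IsSeparable.span (R := ℂ) hC.isSeparable).closure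
    rw [← NonUnitalStarAlgebra.adjoin_eq_span] at h
    exact h
  obtain ⟨c, hc, hcl⟩ := hS
  have : Countable c := hc.to_subtype
  have hsm : Small.{0} (closure c) := by
    have : Small.{0} (ℕ → c) := inferInstance
    classical
    have h0 : ∀ x : closure c, ∃ g : ℕ → c, Filter.Tendsto (fun n => (g n : B)) Filter.atTop
        (nhds (x : B)) := by
      intro x
      obtain ⟨g, hg, hx⟩ := mem_closure_iff_seq_limit.1 x.2
      exact ⟨fun n => ⟨g n, hg n⟩, hx⟩
    choose g hg using h0
    refine small_of_injective (f := g) ?_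
    intro x y hxy
    have h1 := hg x
    rw [hxy] at h1
    exact Subtype.ext (tendsto_nhds_unique h1 (hg y))
  exact small_subset (s := closure c) hcl

/-- A small C⋆-algebra is ⋆-isomorphic to one that lives in `Type`. -/
theorem exists_starAlgEquiv_small (B : Type w) [NonUnitalCStarAlgebra B] [Small.{0} B] :
    ∃ (C : Type) (_ : NonUnitalCStarAlgebra C), Nonempty (C ≃⋆ₐ[ℂ] B) := by
  let e : Shrink.{0} B ≃ B := (equivShrink B).symm
  let i1 : NormedAddCommGroup (Shrink.{0} B) := e.normedAddCommGroup
  let i2 : NonUnitalRing (Shrink.{0} B) := e.nonUnitalRing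
  let i3 : NormedSpace ℂ (Shrink.{0} B) := e.normedSpace ℂ
  let i4 : Star (Shrink.{0} B) := ⟨fun x => e.symm (star (e x))⟩
  have hmul : ∀ x y : Shrink.{0} B, e (x * y) = e x * e y := fun x y => e.apply_symm_apply _
  have hadd : ∀ x y : Shrink.{0} B, e (x + y) = e x + e y := fun x y => e.apply_symm_apply _
  have hsmul : ∀ (c : ℂ) (x : Shrink.{0} B), e (c • x) = c • e x :=
    fun x y => e.apply_symm_apply _
  have hstar : ∀ x : Shrink.{0} B, e (star x) = star (e x) := fun x => e.apply_symm_apply _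
  have hnorm : ∀ x : Shrink.{0} B, ‖x‖ = ‖e x‖ := fun x => rfl
  let i5 : NonUnitalNormedRing (Shrink.{0} B) :=
    { i1, i2 with
      norm_mul_le := fun x y => by
        have := norm_mul_le (e x) (e y)
        rw [← hmul] at this
        exact this }
  let i6 : StarRing (Shrink.{0} B) :=
    { i4 with
      star_involutive := fun x => e.injective (by rw [hstar, hstar, star_star])
      star_mul := fun x y => e.injective (by rw [hstar, hmul, hmul, hstar, hstar, star_mul])
      star_add := fun x y => e.injective (by
        rw [hstar]; erw [hadd, hadd]; rw [hstar, hstar, star_add]) }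
  have hiso : Isometry e := by
    refine Isometry.of_dist_eq fun x y => rfl
  have i7 : CompleteSpace (Shrink.{0} B) :=
    (hiso.isUniformInducing.completeSpace_congr e.surjective).2 inferInstance
  let C : NonUnitalCStarAlgebra (Shrink.{0} B) :=
    { i5, i6, i3 with
      complete := i7.complete
      norm_mul_self_le := fun x => by
        have := CStarRing.norm_mul_self_le (e x)
        rw [← hstar, ← hmul] at this
        exact this
      smul_assoc := fun c x y => e.injective (by
        simp only [smul_eq_mul]
        rw [hmul]; erw [hsmul, hsmul]; rw [hmul, smul_mul_assoc])
      smul_comm := fun c x y => e.injective (by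
        simp only [smul_eq_mul]
        rw [hmul]; erw [hsmul, hsmul]; rw [hmul, mul_smul_comm])
      star_smul := fun c x => e.injective (by
        rw [hstar]; erw [hsmul, hsmul]; rw [hstar, star_smul]) }
  exact ⟨Shrink.{0} B, C, ⟨{ e with
    map_mul' := hmul
    map_add' := hadd
    map_star' := hstar
    map_smul' := hsmul }⟩⟩

namespace GraphCStarAlgebra

variable {E : DirectedGraph.{u}} [E.RowFinite]

/-- The universal property of `C⋆(E)`, for C⋆-algebras in an arbitrary universe. -/
theorem exists_lift {B : Type w} [NonUnitalCStarAlgebra B] (F : CuntzKriegerFamily E B) :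
    ∃ φ : GraphCStarAlgebra E →⋆ₙₐ[ℂ] B,
      (∀ e, φ (s E e) = F.S e) ∧ ∀ v, φ (p E v) = F.P v := by
  let A := (NonUnitalStarAlgebra.adjoin ℂ (Set.range F.gen)).topologicalClosure
  have : IsClosed (A : Set B) := NonUnitalStarSubalgebra.isClosed_topologicalClosure _
  have : Small.{0} A := small_topologicalClosure_adjoin (Set.countable_range _)
  obtain ⟨C, iC, ⟨f⟩⟩ := exists_starAlgEquiv_small A
  let FA : CuntzKriegerFamily E A := F.codRestrict A fun x =>
    NonUnitalStarSubalgebra.le_topologicalClosure _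
      (NonUnitalStarAlgebra.subset_adjoin ℂ _ ⟨x, rfl⟩)
  let R : CKRepresentation E := ⟨C, FA.map (f.symm : A →⋆ₙₐ[ℂ] C)⟩
  let φ : GraphCStarAlgebra E →⋆ₙₐ[ℂ] B :=
    (NonUnitalStarSubalgebraClass.subtype A).comp
      (((f : C →⋆ₙₐ[ℂ] A)).comp
        ((CKProduct.eval E R).comp
          (NonUnitalStarSubalgebraClass.subtype (graphCStarSubalgebra E))))
  refine ⟨φ, fun e => ?_, fun v => ?_⟩
  · change ((f (f.symm (FA.S e)) : A) : B) = F.S e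
    rw [f.apply_symm_apply]
    rfl
  · change ((f (f.symm (FA.P v)) : A) : B) = F.P v
    rw [f.apply_symm_apply]
    rfl

/-- The ⋆-homomorphism `C⋆(E) → B` given by a Cuntz–Krieger `E`-family in `B`. -/
def lift {B : Type w} [NonUnitalCStarAlgebra B] (F : CuntzKriegerFamily E B) :
    GraphCStarAlgebra E →⋆ₙₐ[ℂ] B :=
  (exists_lift F).choose

@[simp]
theorem lift_s {B : Type w} [NonUnitalCStarAlgebra B] (F : CuntzKriegerFamily E B) (e : E.Edge) :
    lift F (s E e) = F.S e :=
  (exists_lift F).choose_spec.1 e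

@[simp]
theorem lift_p {B : Type w} [NonUnitalCStarAlgebra B] (F : CuntzKriegerFamily E B)
    (v : E.Vertex) : lift F (p E v) = F.P v :=
  (exists_lift F).choose_spec.2 v

end GraphCStarAlgebra

/-! ### Circle actions -/

/-- A strongly continuous action of the circle group on a C⋆-algebra by ⋆-automorphisms (each
`hom z` is invertible with inverse `hom z⁻¹`). -/
structure CircleAction (A : Type w) [NonUnitalCStarAlgebra A] where
  hom : Circle →* (A →⋆ₙₐ[ℂ] A)
  continuous_hom : ∀ a : A, Continuous fun z : Circle => hom z a

namespace GraphCStarAlgebra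

variable (E : DirectedGraph.{u}) [E.RowFinite]

/-- The canonical gauge action: `γ_z(s_e) = z s_e` and `γ_z(p_v) = p_v`. -/
def gaugeAction : CircleAction (GraphCStarAlgebra E) where
  hom :=
    { toFun := fun z => lift ((family E).rotate z)
      map_one' := by
        refine hom_ext (fun e => ?_) (fun v => ?_)
        · rw [lift_s]; simp [CuntzKriegerFamily.rotate]
        · rw [lift_p]; rfl
      map_mul' := fun z w => by
        refine hom_ext (fun e => ?_) (fun v => ?_)
        · change _ = lift ((family E).rotate z) (lift ((family E).rotate w) (s E e))
          rw [lift_s, lift_s]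
          simp only [CuntzKriegerFamily.rotate]
          rw [map_smul, lift_s, Circle.coe_mul, smul_smul, mul_comm]
        · change _ = lift ((family E).rotate z) (lift ((family E).rotate w) (p E v))
          rw [lift_p, lift_p]
          simp only [CuntzKriegerFamily.rotate]
          rw [lift_p] }
  continuous_hom := by
    let γ : Circle → (GraphCStarAlgebra E →⋆ₙₐ[ℂ] GraphCStarAlgebra E) :=
      fun z => lift ((family E).rotate z)
    change ∀ a, Continuous fun z => γ z a
    have hcl : IsClosed {a : GraphCStarAlgebra E | Continuous fun z => γ z a} := by
      rw [← isSeqClosed_iff_isClosed]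
      intro x a hx hxa
      have hu : TendstoUniformly (fun n z => γ z (x n)) (fun z => γ z a) Filter.atTop := by
        rw [Metric.tendstoUniformly_iff]
        intro ε hε
        filter_upwards [Metric.tendsto_nhds.1 hxa ε hε] with n hn z
        rw [dist_comm, dist_eq_norm, ← map_sub]
        refine lt_of_le_of_lt (NonUnitalStarAlgHom.norm_apply_le (γ z) _) ?_
        rwa [← dist_eq_norm]
      exact hu.continuous (Filter.Frequently.of_forall fun n => hx n)
    let T : NonUnitalStarSubalgebra ℂ (GraphCStarAlgebra E) :=
      { carrier := {a | Continuous fun z => γ z a}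
        add_mem' := fun {a b} ha hb => by
          simp only [Set.mem_ofPred_eq, map_add]
          exact Continuous.add ha hb
        zero_mem' := by simpa using continuous_const
        mul_mem' := fun {a b} ha hb => by
          simp only [Set.mem_ofPred_eq, map_mul]
          exact Continuous.mul ha hb
        smul_mem' := fun c a ha => by
          simp only [Set.mem_ofPred_eq, map_smul]
          exact Continuous.const_smul ha c
        star_mem' := fun {a} ha => by
          simp only [Set.mem_ofPred_eq, map_star]
          exact Continuous.star ha }
    have hT : (NonUnitalStarAlgebra.adjoin ℂ (Set.range (family E).gen)).topologicalClosure ≤ T := by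
      refine NonUnitalStarSubalgebra.topologicalClosure_minimal _
        (NonUnitalStarAlgebra.adjoin_le ?_) hcl
      rintro _ ⟨x, rfl⟩
      cases x with
      | inl e =>
        change Continuous fun z => γ z (s E e)
        simp only [γ, lift_s, CuntzKriegerFamily.rotate]
        exact Continuous.smul continuous_subtype_val continuous_const
      | inr v =>
        change Continuous fun z => γ z (p E v)
        simp only [γ, lift_p, CuntzKriegerFamily.rotate]
        exact continuous_const
    intro a
    rw [adjoin_family_dense] at hT
    exact hT (show a ∈ (⊤ : NonUnitalStarSubalgebra ℂ (GraphCStarAlgebra E)) from trivial)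

theorem gaugeAction_s (z : Circle) (e : E.Edge) :
    (gaugeAction E).hom z (s E e) = (z : ℂ) • s E e :=
  lift_s _ e

theorem gaugeAction_p (z : Circle) (v : E.Vertex) :
    (gaugeAction E).hom z (p E v) = p E v :=
  lift_p _ v

/-- The diagonal subalgebra `D(E)`: the C⋆-subalgebra of `C⋆(E)` generated by the projections
`s_μ s_μ⋆` for all finite paths `μ`, vertices included. -/
def diagonal : NonUnitalStarSubalgebra ℂ (GraphCStarAlgebra E) :=
  (NonUnitalStarAlgebra.adjoin ℂ {x : GraphCStarAlgebra E | ∃ (v w : E.Vertex)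
    (μ : E.FinPath v w), x = (family E).path μ * star ((family E).path μ)}).topologicalClosure

end GraphCStarAlgebra

/-! ### Multiplier projections, corners and Morita equivalence -/

namespace DoubleCentralizer

variable {A : Type w} [NonUnitalCStarAlgebra A]

/-- The compression `a ↦ P a P` of `A` by a multiplier `P`. -/
def compress (P : 𝓜(ℂ, A)) (a : A) : A := P.fst (P.snd a)

lemma eq_of_mul_left_eq {a b : A} (h : ∀ x : A, x * a = x * b) : a = b := by
  have h1 := h (star (a - b))
  rw [← sub_eq_zero, ← mul_sub, CStarRing.star_mul_self_eq_zero_iff] at h1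
  exact sub_eq_zero.1 h1

lemma eq_of_mul_right_eq {a b : A} (h : ∀ x : A, a * x = b * x) : a = b := by
  have h1 := h (star (a - b))
  rw [← sub_eq_zero, ← sub_mul, CStarRing.mul_star_self_eq_zero_iff] at h1
  exact sub_eq_zero.1 h1

lemma fst_mul_right (P : 𝓜(ℂ, A)) (a b : A) : P.fst (a * b) = P.fst a * b :=
  eq_of_mul_left_eq fun x => by
    rw [← P.central, ← mul_assoc, ← mul_assoc, P.central]

lemma snd_mul_left (P : 𝓜(ℂ, A)) (a b : A) : P.snd (a * b) = a * P.snd b :=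
  eq_of_mul_right_eq fun x => by
    rw [P.central, mul_assoc, mul_assoc, P.central]

lemma fst_snd_comm (P : 𝓜(ℂ, A)) (a : A) : P.fst (P.snd a) = P.snd (P.fst a) :=
  eq_of_mul_right_eq fun x => by
    rw [← fst_mul_right, P.central, P.central, fst_mul_right]

lemma mem_range_compress_iff (P : 𝓜(ℂ, A)) (hP : IsStarProjection P) (a : A) :
    a ∈ Set.range P.compress ↔ P.fst a = a ∧ P.snd a = a := by
  have h1 : ∀ x, P.fst (P.fst x) = P.fst x := fun x => by
    have := congrArg (fun Q : 𝓜(ℂ, A) => Q.fst x) hP.isIdempotentElem.eq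
    simpa using this
  have h2 : ∀ x, P.snd (P.snd x) = P.snd x := fun x => by
    have := congrArg (fun Q : 𝓜(ℂ, A) => Q.snd x) hP.isIdempotentElem.eq
    simpa using this
  constructor
  · rintro ⟨x, rfl⟩
    refine ⟨h1 _, ?_⟩
    simp only [compress]
    rw [fst_snd_comm, h2]
  · rintro ⟨ha, hb⟩
    exact ⟨a, by rw [compress, hb, ha]⟩

/-- The corner `P A P` of a projection `P` in the multiplier algebra of `A`. -/
def corner (P : 𝓜(ℂ, A)) (hP : IsStarProjection P) : NonUnitalStarSubalgebra ℂ A where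
  carrier := Set.range P.compress
  add_mem' := by
    rintro _ _ ⟨a, rfl⟩ ⟨b, rfl⟩
    exact ⟨a + b, by simp [compress]⟩
  zero_mem' := ⟨0, by simp [compress]⟩
  smul_mem' := by
    rintro c _ ⟨a, rfl⟩
    exact ⟨c • a, by simp [compress]⟩
  mul_mem' := by
    intro a b ha hb
    rw [mem_range_compress_iff P hP] at ha hb ⊢
    rw [fst_mul_right, snd_mul_left, ha.1, hb.2]
    exact ⟨rfl, rfl⟩
  star_mem' := by
    intro a ha
    rw [mem_range_compress_iff P hP] at ha ⊢
    have h1 := star_fst P (star a)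
    have h2 := star_snd P (star a)
    rw [hP.isSelfAdjoint.star_eq, star_star] at h1 h2
    rw [h1, h2, ha.1, ha.2]
    exact ⟨rfl, rfl⟩

/-- A projection `P` in the multiplier algebra of `A` is full if the linear span of `A P A` is dense
in `A`. -/
def IsFull (P : 𝓜(ℂ, A)) : Prop :=
  (Submodule.span ℂ {x : A | ∃ a b : A, x = a * P.fst b}).topologicalClosure = ⊤

/-- `P = ∑ i, f i` in the multiplier algebra of `A`, with unconditional convergence in the strict
topology: `∑ i, f i a = P a` and `∑ i, a f i = a P` in norm for all `a`. -/
def IsStrictSum {ι : Type v} (f : ι → A) (P : 𝓜(ℂ, A)) : Prop :=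
  ∀ a : A, HasSum (fun i => f i * a) (P.fst a) ∧ HasSum (fun i => a * f i) (P.snd a)

end DoubleCentralizer

/-- Morita equivalence of triples `(A, α, D)`, `(B, β, D')` of a C⋆-algebra, a circle action and a
distinguished subalgebra: `A` and `B` are identified with complementary full corners of a
C⋆-algebra `C` that carries a circle action and a distinguished C⋆-subalgebra, compatibly. -/
def TripleMoritaEquivalent {A B : Type w} [NonUnitalCStarAlgebra A] [NonUnitalCStarAlgebra B]
    (α : CircleAction A) (DA : NonUnitalStarSubalgebra ℂ A)
    (β : CircleAction B) (DB : NonUnitalStarSubalgebra ℂ B) : Prop :=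
  ∃ (C : Type w) (_ : NonUnitalCStarAlgebra C) (P₁ P₂ : 𝓜(ℂ, C))
    (hP₁ : IsStarProjection P₁) (hP₂ : IsStarProjection P₂)
    (γ : CircleAction C) (DC : NonUnitalStarSubalgebra ℂ C)
    (π₁ : A ≃⋆ₐ[ℂ] P₁.corner hP₁) (π₂ : B ≃⋆ₐ[ℂ] P₂.corner hP₂),
    P₁.IsFull ∧ P₂.IsFull ∧ P₁ + P₂ = 1 ∧ IsClosed (DC : Set C) ∧
    (∀ (z : Circle) (a : A), (π₁ (α.hom z a) : C) = γ.hom z (π₁ a)) ∧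
    (∀ (z : Circle) (b : B), (π₂ (β.hom z b) : C) = γ.hom z (π₂ b)) ∧
    (fun a : A => (π₁ a : C)) '' DA = (fun c : C => P₁.fst c) '' DC ∧
    (fun b : B => (π₂ b : C)) '' DB = (fun c : C => P₂.fst c) '' DC

end

/-!
# Elementary strong shift equivalence and Morita equivalence of graph C⋆-algebras

Let `E₁` and `E₂` be elementary strong shift equivalent via `E₃`. An edge `e` of `E₁` is a path `ηξ`
of length two in `E₃`, and the products `s_η s_ξ` with the projections `p_v`, `v ∈ E₁⁰`, form a
Cuntz–Krieger `E₁`-family in `C⋆(E₃)` (`CuntzKriegerFamily.contract`). The source condition enters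
here: an edge that leaves a source is the only edge at its range `v`, so `v` is a source of `E₁` and
no relation is required there. The result is a ⋆-homomorphism `GraphCStarAlgebra.cornerHom : C⋆(E₁)
→ C⋆(E₃)` into the corner of `P₁ = ∑ p_v`.

It is injective because the construction can be undone. Given a Cuntz–Krieger `E₁`-family in a
C⋆-algebra `A`, consider matrices over `A` with one index for the vertices of `E₁`, one for each
edge `ξ` of `E₃` out of `E₁`, and one for each edge `η` that leaves a source of `E₃` outside `E₁`.
They contain a Cuntz–Krieger `E₃`-family (`CuntzKriegerFamily.expand`): `ξ` acts by moving the first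
index to its own, and an edge `η` into `E₁` has the entries `S_{ηξ}` in its row, or the identity if
it leaves a source. The composite `C⋆(E₁) → C⋆(E₃) → matrices` is the inclusion in the first
diagonal position, so that no uniqueness theorem for graph algebras is needed. A C⋆-algebra that
contains these matrices, at least to the extent that a given `a ≠ 0` survives, is supplied by
`exists_matrixUnits`: the Hahn–Banach theorem gives a positive functional that does not vanish at
`(a a⋆)²`, the GNS construction represents `a` by a nonzero operator on a Hilbert space, and the
matrices act on a Hilbert sum of copies of that space.

The range is the whole corner for the same reason: the elements `x` of `C⋆(E₃)` all of whose matrix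
entries `p_v x`, `s_ξ⋆ x`, `s_η x` lie in the range form a closed left ideal that contains `p_w` for
`w ∈ E₁⁰` (`GraphCStarAlgebra.row_mul_mul_mem_range`). The assertion on the diagonals is an
induction on paths of `E₃` (`GraphCStarAlgebra.rangeProj_mem_image`), and the circle action gives
weight one to the edges into `E₁` and weight zero to the others, so that the paths of length two
that stand for edges of `E₁` or `E₂` have weight one. The hypotheses are symmetric in `E₁` and `E₂`,
hence everything is done for `E₁` and applied twice.
-/

/-! ### Amplifications of C⋆-algebras by matrix units -/

section amplification

open scoped ComplexOrder InnerProductSpace ComplexStarModule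

/-- A positive functional that does not vanish at a given nonzero positive element `c`: the real
Hahn–Banach theorem separates `-c` from the closed cone of positive elements. -/
theorem exists_positiveLinearMap_ne_zero {A : Type w} [NonUnitalCStarAlgebra A] [PartialOrder A]
    [StarOrderedRing A] {c : A} (hc : 0 ≤ c) (hc0 : c ≠ 0) : ∃ f : A →ₚ[ℂ] ℂ, f c ≠ 0 := by
  have hconv : Convex ℝ {a : A | 0 ≤ a} := by
    intro a ha b hb s t hs ht _
    exact add_nonneg (smul_nonneg hs ha) (smul_nonneg ht hb)
  have hneg : -c ∉ {a : A | 0 ≤ a} := by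
    intro h
    exact hc0 (le_antisymm (neg_nonneg.1 h) hc)
  obtain ⟨g, u, hgu, hg⟩ := geometric_hahn_banach_point_closed hconv
    CStarAlgebra.isClosed_nonneg hneg
  have hu : u < 0 := by simpa using hg 0 le_rfl
  have hgpos : ∀ a : A, 0 ≤ a → 0 ≤ g a := by
    intro a ha
    by_contra! hlt
    have hnn : (0 : ℝ) ≤ u / g a := div_nonneg_of_nonpos hu.le hlt.le
    have := hg ((u / g a) • a) (smul_nonneg hnn ha)
    rw [map_smul, smul_eq_mul, div_mul_cancel₀ _ hlt.ne] at this
    exact lt_irrefl _ this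
  -- the complex-linear extension of the restriction of `g` to the self-adjoint part
  let f : A →ₗ[ℂ] ℂ :=
    { toFun := fun a => (g (ℜ a : A) : ℂ) + Complex.I * (g (ℑ a : A) : ℂ)
      map_add' := fun a b => by
        simp only [map_add, AddSubgroup.coe_add, Complex.ofReal_add]
        ring
      map_smul' := fun z a => by
        rw [realPart_smul, imaginaryPart_smul]
        simp only [AddSubgroupClass.coe_sub, AddSubgroup.coe_add, selfAdjoint.val_smul, map_sub,
          map_add, map_smul, smul_eq_mul, Complex.ofReal_sub, Complex.ofReal_add,
          Complex.ofReal_mul, RingHom.id_apply]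
        conv_rhs => rw [← Complex.re_add_im z]
        linear_combination (-(z.im : ℂ) * (g (ℑ a : A) : ℂ)) * Complex.I_sq }
  have hf : ∀ a : A, 0 ≤ a → f a = (g a : ℂ) := by
    intro a ha
    have h1 : (ℜ a : A) = a := ha.isSelfAdjoint.coe_realPart
    have h2 : ℑ a = 0 := ha.isSelfAdjoint.imaginaryPart
    change (g (ℜ a : A) : ℂ) + Complex.I * (g (ℑ a : A) : ℂ) = _
    rw [h1, h2]
    simp
  refine ⟨PositiveLinearMap.mk₀ f fun a ha => ?_, ?_⟩
  · rw [hf a ha]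
    exact_mod_cast hgpos a ha
  · change f c ≠ 0
    rw [hf c hc]
    have : 0 < g c := by
      have := hgu.trans hu
      rw [map_neg] at this
      linarith
    exact_mod_cast this.ne'

/-- Representations on Hilbert spaces separate the points of a C⋆-algebra. -/
theorem exists_hilbert_representation {A : Type w} [NonUnitalCStarAlgebra A] {b : A} (hb : b ≠ 0) :
    ∃ (H : Type w) (_ : NormedAddCommGroup H) (_ : InnerProductSpace ℂ H) (_ : CompleteSpace H)
      (ρ : A →⋆ₙₐ[ℂ] (H →L[ℂ] H)), ρ b ≠ 0 := by
  let _ : PartialOrder A := CStarAlgebra.spectralOrder A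
  have _ : StarOrderedRing A := CStarAlgebra.spectralOrderedRing A
  have h1 : b * star b ≠ 0 := by simpa [CStarRing.mul_star_self_eq_zero_iff] using hb
  have h2 : star (b * star b) * (b * star b) ≠ 0 := by
    rwa [Ne, CStarRing.star_mul_self_eq_zero_iff]
  obtain ⟨f, hf⟩ := exists_positiveLinearMap_ne_zero (star_mul_self_nonneg (b * star b)) h2
  refine ⟨f.GNS, inferInstance, inferInstance, inferInstance, f.gnsNonUnitalStarAlgHom, ?_⟩
  intro h
  -- the vector of `b⋆` is moved to the vector of `b b⋆`, whose norm is not zero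
  have h3 := congrArg (fun T : f.GNS →L[ℂ] f.GNS => T (f.toPreGNS (star b) : f.GNS)) h
  simp only [PositiveLinearMap.gnsNonUnitalStarAlgHom_apply_coe] at h3
  have h4 : ‖f.toPreGNS (b * star b)‖ = 0 := by
    rw [← UniformSpace.Completion.norm_coe, norm_eq_zero]
    simpa using h3
  apply hf
  have h5 := f.preGNS_norm_sq (f.toPreGNS (b * star b))
  rw [h4] at h5
  simpa using h5.symm

/-- A system of matrix units over `A`, indexed by `I`, in a C⋆-algebra `B`: `unit i j a` plays the
part of the matrix with the single entry `a` in position `(i, j)`. -/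
structure MatrixUnits (I : Type v) (A : Type w) [NonUnitalCStarAlgebra A]
    (B : Type u) [NonUnitalCStarAlgebra B] where
  unit : I → I → A →ₗ[ℂ] B
  unit_mul_unit : ∀ i j k a b, unit i j a * unit j k b = unit i k (a * b)
  unit_mul_unit_of_ne : ∀ i j k l a b, j ≠ k → unit i j a * unit k l b = 0
  star_unit : ∀ i j a, star (unit i j a) = unit j i (star a)

/-- Matrix units that do not annihilate a given nonzero element `b` exist over every C⋆-algebra and
for every index set, finite or not: they act on a Hilbert sum of copies of a space on which `b` is
represented by a nonzero operator. -/
theorem exists_matrixUnits (I : Type v) {A : Type w} [NonUnitalCStarAlgebra A] {b : A}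
    (hb : b ≠ 0) :
    ∃ (B : Type max v w) (_ : NonUnitalCStarAlgebra B) (m : MatrixUnits I A B),
      ∀ i, m.unit i i b ≠ 0 := by
  classical
  obtain ⟨H, _, _, _, ρ, hρ⟩ := exists_hilbert_representation hb
  let K := lp (fun _ : I => H) 2
  let V : I → H →L[ℂ] K := fun i => lp.singleContinuousLinearMap ℂ (fun _ : I => H) 2 i
  have hV : ∀ i (f : K), ContinuousLinearMap.adjoint (V i) f = f i := by
    intro i f
    refine ext_inner_left ℂ fun x => ?_
    rw [ContinuousLinearMap.adjoint_inner_right]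
    exact lp.inner_single_left (𝕜 := ℂ) (G := fun _ : I => H) i x f
  have hVV : ∀ i x, ContinuousLinearMap.adjoint (V i) (V i x) = x := by
    intro i x
    rw [hV]
    exact lp.single_apply_self (E := fun _ : I => H) 2 i x
  have hVne : ∀ i j x, i ≠ j → ContinuousLinearMap.adjoint (V i) (V j x) = 0 := by
    intro i j x hij
    rw [hV]
    exact lp.single_apply_ne (E := fun _ : I => H) 2 j x hij
  let U : I → I → A →ₗ[ℂ] (K →L[ℂ] K) := fun i j =>
    { toFun := fun a => V i ∘L ρ a ∘L ContinuousLinearMap.adjoint (V j)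
      map_add' := fun a b => by ext1 x; simp
      map_smul' := fun c a => by ext1 x; simp }
  have hU : ∀ i j a x, U i j a x = V i (ρ a (ContinuousLinearMap.adjoint (V j) x)) :=
    fun _ _ _ _ => rfl
  refine ⟨K →L[ℂ] K, inferInstance, ⟨U, ?_, ?_, ?_⟩, ?_⟩
  · intro i j k a b
    ext1 x
    rw [mul_apply_eq_comp, hU, hU, hU, hVV, map_mul, mul_apply_eq_comp]
  · intro i j k l a b hjk
    ext1 x
    rw [mul_apply_eq_comp, hU, hU, hVne _ _ _ hjk]
    simp
  · intro i j a
    change star (V i ∘L ρ a ∘L ContinuousLinearMap.adjoint (V j)) =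
      V j ∘L ρ (star a) ∘L ContinuousLinearMap.adjoint (V i)
    rw [ContinuousLinearMap.star_eq_adjoint, ContinuousLinearMap.adjoint_comp,
      ContinuousLinearMap.adjoint_comp, ContinuousLinearMap.adjoint_adjoint, map_star,
      ContinuousLinearMap.star_eq_adjoint]
    rfl
  · intro i h
    apply hρ
    ext1 x
    have h1 : U i i b (V i x) = 0 := by
      rw [show U i i b = 0 from h]; rfl
    rw [hU, hVV] at h1
    have h2 := congrArg (ContinuousLinearMap.adjoint (V i)) h1
    rw [hVV] at h2
    simpa using h2

namespace MatrixUnits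

variable {I : Type v} {A : Type w} [NonUnitalCStarAlgebra A] {B : Type u}
  [NonUnitalCStarAlgebra B]

/-- The inclusion of `A` in a diagonal position. -/
def diag (m : MatrixUnits I A B) (i : I) : A →⋆ₙₐ[ℂ] B :=
  { m.unit i i with
    map_zero' := map_zero (m.unit i i)
    map_mul' := fun a b => (m.unit_mul_unit i i i a b).symm
    map_star' := fun a => (m.star_unit i i a).symm }

end MatrixUnits

end amplification

/-! ### Relations in Cuntz–Krieger families -/

section families

theorem DirectedGraph.not_isSource_r {E : DirectedGraph.{u}} (e : E.Edge) : ¬ E.IsSource (E.r e) :=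
  fun h => Set.eq_empty_iff_forall_notMem.1 h e rfl

variable {E : DirectedGraph.{u}} [E.RowFinite]

theorem DirectedGraph.mem_edgesInto {v : E.Vertex} {e : E.Edge} :
    e ∈ E.edgesInto v ↔ E.r e = v := by
  simp [DirectedGraph.edgesInto]

namespace CuntzKriegerFamily

variable {B : Type v} [NonUnitalCStarAlgebra B] (F : CuntzKriegerFamily E B)

theorem P_mul_self (v : E.Vertex) : F.P v * F.P v = F.P v :=
  (F.isStarProjection_P v).isIdempotentElem.eq

theorem star_P (v : E.Vertex) : star (F.P v) = F.P v :=
  (F.isStarProjection_P v).isSelfAdjoint.star_eq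

theorem S_mul_P (e : E.Edge) : F.S e * F.P (E.s e) = F.S e := by
  rw [← F.ck1, ← mul_assoc, F.partialIsometry_S]

theorem P_mul_S (e : E.Edge) : F.P (E.r e) * F.S e = F.S e := by
  classical
  rw [F.ck2 _ (DirectedGraph.not_isSource_r e), Finset.sum_mul,
    Finset.sum_eq_single_of_mem e (DirectedGraph.mem_edgesInto.2 rfl), F.partialIsometry_S]
  intro f _ hf
  rw [mul_assoc, F.orthogonal_S f e hf, mul_zero]

theorem P_mul_S_of_ne {v : E.Vertex} {e : E.Edge} (h : v ≠ E.r e) : F.P v * F.S e = 0 := by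
  rw [← F.P_mul_S, ← mul_assoc, F.orthogonal_P _ _ h, zero_mul]

theorem S_mul_P_of_ne {v : E.Vertex} {e : E.Edge} (h : E.s e ≠ v) : F.S e * F.P v = 0 := by
  rw [← F.S_mul_P, mul_assoc, F.orthogonal_P _ _ h, mul_zero]

theorem star_S_mul_P (e : E.Edge) : star (F.S e) * F.P (E.r e) = star (F.S e) := by
  rw [← F.star_P, ← star_mul, F.P_mul_S]

theorem P_mul_star_S (e : E.Edge) : F.P (E.s e) * star (F.S e) = star (F.S e) := by
  rw [← F.star_P, ← star_mul, F.S_mul_P]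

theorem star_S_mul_P_of_ne {v : E.Vertex} {e : E.Edge} (h : v ≠ E.r e) :
    star (F.S e) * F.P v = 0 := by
  rw [← F.star_P, ← star_mul, F.P_mul_S_of_ne h, star_zero]

theorem P_mul_star_S_of_ne {v : E.Vertex} {e : E.Edge} (h : E.s e ≠ v) :
    F.P v * star (F.S e) = 0 := by
  rw [← F.star_P, ← star_mul, F.S_mul_P_of_ne h, star_zero]

theorem S_mul_S_of_ne {e f : E.Edge} (h : E.s e ≠ E.r f) : F.S e * F.S f = 0 := by
  rw [← F.P_mul_S f, ← mul_assoc, F.S_mul_P_of_ne h, zero_mul]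

theorem S_mul_star_S_of_ne {e f : E.Edge} (h : E.s e ≠ E.s f) : F.S e * star (F.S f) = 0 := by
  rw [← F.P_mul_star_S f, ← mul_assoc, F.S_mul_P_of_ne h, zero_mul]

theorem P_mul_path {v w : E.Vertex} (μ : E.FinPath v w) : F.P v * F.path μ = F.path μ := by
  cases μ with
  | vertex => exact F.P_mul_self v
  | cons e μ => rw [path, ← mul_assoc, F.P_mul_S]

/-- The range projection `S_μ S_μ⋆` of a path. -/
def rangeProj {v w : E.Vertex} (μ : E.FinPath v w) : B := F.path μ * star (F.path μ)

theorem rangeProj_vertex (v : E.Vertex) : F.rangeProj (.vertex v) = F.P v := by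
  rw [rangeProj, path, F.star_P, F.P_mul_self]

theorem rangeProj_cons (e : E.Edge) {w : E.Vertex} (μ : E.FinPath (E.s e) w) :
    F.rangeProj (.cons e μ) = F.S e * F.rangeProj μ * star (F.S e) := by
  simp only [rangeProj, path, star_mul, mul_assoc]

theorem P_mul_rangeProj {v w : E.Vertex} (μ : E.FinPath v w) :
    F.P v * F.rangeProj μ = F.rangeProj μ := by
  rw [rangeProj, ← mul_assoc, F.P_mul_path]

theorem rangeProj_mul_P {v w : E.Vertex} (μ : E.FinPath v w) :
    F.rangeProj μ * F.P v = F.rangeProj μ := by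
  rw [rangeProj, mul_assoc, ← F.star_P, ← star_mul, F.P_mul_path]

theorem isStarProjection_sum_P {ι : Type w} {j : ι → E.Vertex} (hj : Function.Injective j)
    (s : Finset ι) : IsStarProjection (∑ i ∈ s, F.P (j i)) where
  isIdempotentElem := by
    classical
    rw [IsIdempotentElem, Finset.sum_mul_sum]
    refine Finset.sum_congr rfl fun i hi => ?_
    rw [Finset.sum_eq_single_of_mem i hi fun k _ hk =>
      F.orthogonal_P _ _ fun h => hk (hj h).symm, F.P_mul_self]
  isSelfAdjoint := by
    rw [IsSelfAdjoint, star_sum]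
    exact Finset.sum_congr rfl fun i _ => F.star_P _

/-- The family obtained by multiplying each `S e` by a scalar `c e` of modulus one. -/
def twist (c : E.Edge → Circle) : CuntzKriegerFamily E B where
  S e := (c e : ℂ) • F.S e
  P v := F.P v
  isStarProjection_P := F.isStarProjection_P
  orthogonal_P := F.orthogonal_P
  partialIsometry_S e := (F.rotate (c e)).partialIsometry_S e
  orthogonal_S e f h := by
    simp only [star_smul, smul_mul_smul_comm, F.orthogonal_S e f h, smul_zero]
  ck1 e := (F.rotate (c e)).ck1 e
  ck2 v h := by
    rw [F.ck2 v h]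
    refine Finset.sum_congr rfl fun e _ => ?_
    have hz : (c e : ℂ) * star (c e : ℂ) = 1 := by simp [Complex.mul_conj]
    rw [star_smul, smul_mul_smul_comm, hz, one_smul]

end CuntzKriegerFamily

end families

namespace GraphCStarAlgebra

section generation

variable {E : DirectedGraph.{u}} [E.RowFinite]

/-- Induction on the elements of `C⋆(E)` for closed predicates. -/
theorem dense_induction {q : GraphCStarAlgebra E → Prop} (closed : IsClosed {a | q a})
    (zero : q 0) (add : ∀ a b, q a → q b → q (a + b)) (smul : ∀ (c : ℂ) a, q a → q (c • a))
    (mul : ∀ a b, q a → q b → q (a * b)) (hs : ∀ e, q (s E e)) (hs' : ∀ e, q (star (s E e)))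
    (hp : ∀ v, q (p E v)) (a : GraphCStarAlgebra E) : q a := by
  have ha : a ∈ (NonUnitalStarAlgebra.adjoin ℂ (Set.range (family E).gen)).topologicalClosure := by
    rw [adjoin_family_dense]; trivial
  refine closure_minimal (t := {a | q a}) ?_ closed ha
  intro x hx
  have hx' : x ∈ NonUnitalAlgebra.adjoin ℂ
      (Set.range (family E).gen ∪ star (Set.range (family E).gen)) := by
    rw [← NonUnitalStarAlgebra.adjoin_toNonUnitalSubalgebra]; exact hx
  clear hx
  change q x
  induction hx' using NonUnitalAlgebra.adjoin_induction with
  | mem x hx =>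
    rcases hx with ⟨y, rfl⟩ | ⟨y, hy⟩
    · cases y with
      | inl e => exact hs e
      | inr v => exact hp v
    · rw [← star_star x, ← hy]
      cases y with
      | inl e => exact hs' e
      | inr v =>
        change q (star ((family E).P v))
        rw [(family E).star_P]
        exact hp v
  | add x y _ _ hx hy => exact add x y hx hy
  | zero => exact zero
  | mul x y _ _ hx hy => exact mul x y hx hy
  | smul c x _ hx => exact smul c x hx

end generation

/-! ### Weighted gauge actions -/

section weighted

variable (E : DirectedGraph.{u}) [E.RowFinite]

/-- The action of the circle with `s_e ↦ z ^ n(e) s_e` and `p_v ↦ p_v`, for integral weights `n(e)`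
of the edges. -/
noncomputable def weightedGaugeAction (n : E.Edge → ℕ) : CircleAction (GraphCStarAlgebra E) where
  hom :=
    { toFun := fun z => lift ((family E).twist fun e => z ^ n e)
      map_one' := by
        refine hom_ext (fun e => ?_) (fun v => ?_)
        · rw [lift_s]; simp [CuntzKriegerFamily.twist]
        · rw [lift_p]; rfl
      map_mul' := fun z w => by
        refine hom_ext (fun e => ?_) (fun v => ?_)
        · change _ = lift ((family E).twist fun e => z ^ n e)
            (lift ((family E).twist fun e => w ^ n e) (s E e))
          rw [lift_s, lift_s]
          simp only [CuntzKriegerFamily.twist]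
          rw [map_smul, lift_s, mul_pow, Circle.coe_mul, smul_smul, mul_comm]
        · change _ = lift ((family E).twist fun e => z ^ n e)
            (lift ((family E).twist fun e => w ^ n e) (p E v))
          rw [lift_p, lift_p]
          simp only [CuntzKriegerFamily.twist]
          rw [lift_p] }
  continuous_hom := by
    let γ : Circle → (GraphCStarAlgebra E →⋆ₙₐ[ℂ] GraphCStarAlgebra E) :=
      fun z => lift ((family E).twist fun e => z ^ n e)
    change ∀ a, Continuous fun z => γ z a
    have hs : ∀ e, Continuous fun z => γ z (s E e) := by
      intro e
      simp only [γ, lift_s, CuntzKriegerFamily.twist]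
      exact Continuous.smul (continuous_subtype_val.comp (continuous_pow (n e))) continuous_const
    refine dense_induction ?_ (by simpa using continuous_const)
      (fun a b ha hb => by simp only [map_add]; exact Continuous.add ha hb)
      (fun c a ha => by simp only [map_smul]; exact Continuous.const_smul ha c)
      (fun a b ha hb => by simp only [map_mul]; exact Continuous.mul ha hb) hs
      (fun e => by simpa only [map_star] using (hs e).star) ?_
    · rw [← isSeqClosed_iff_isClosed]
      intro x a hx hxa
      have hu : TendstoUniformly (fun n z => γ z (x n)) (fun z => γ z a) Filter.atTop := by
        rw [Metric.tendstoUniformly_iff]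
        intro ε hε
        filter_upwards [Metric.tendsto_nhds.1 hxa ε hε] with n hn z
        rw [dist_comm, dist_eq_norm, ← map_sub]
        refine lt_of_le_of_lt (NonUnitalStarAlgHom.norm_apply_le (γ z) _) ?_
        rwa [← dist_eq_norm]
      exact hu.continuous (Filter.Frequently.of_forall fun n => hx n)
    · intro v
      simp only [γ, lift_p, CuntzKriegerFamily.twist]
      exact continuous_const

variable {E}

theorem weightedGaugeAction_s (n : E.Edge → ℕ) (z : Circle) (e : E.Edge) :
    (weightedGaugeAction E n).hom z (s E e) = ((z ^ n e : Circle) : ℂ) • s E e :=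
  lift_s _ e

theorem weightedGaugeAction_p (n : E.Edge → ℕ) (z : Circle) (v : E.Vertex) :
    (weightedGaugeAction E n).hom z (p E v) = p E v :=
  lift_p _ v

end weighted

/-! ### Sums of vertex projections in the multiplier algebra -/

section multipliers

variable {E : DirectedGraph.{u}} [E.RowFinite]

theorem norm_sum_p_mul_le {ι : Type v} {j : ι → E.Vertex} (hj : Function.Injective j)
    (t : Finset ι) (a : GraphCStarAlgebra E) : ‖∑ i ∈ t, p E (j i) * a‖ ≤ ‖a‖ := by
  rw [← Finset.sum_mul]
  calc _ ≤ ‖∑ i ∈ t, p E (j i)‖ * ‖a‖ := norm_mul_le _ _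
    _ ≤ 1 * ‖a‖ := by
      gcongr
      exact ((family E).isStarProjection_sum_P hj t).norm_le
    _ = ‖a‖ := one_mul _

theorem star_p (v : E.Vertex) : star (p E v) = p E v :=
  (family E).star_P v

/-- The vertex projections sum strictly to the identity. -/
theorem hasSum_p_mul (a : GraphCStarAlgebra E) : HasSum (fun v => p E v * a) a := by
  classical
  have hsingle : ∀ (v : E.Vertex) (a : GraphCStarAlgebra E), p E v * a = a →
      HasSum (fun w => p E w * a) a := by
    intro v a ha
    have := hasSum_single (f := fun w => p E w * a) v fun w hw => by
      rw [← ha, ← mul_assoc, (family E).orthogonal_P w v hw, zero_mul]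
    rwa [ha] at this
  refine dense_induction (q := fun a => HasSum (fun v => p E v * a) a) ?_ ?_ ?_ ?_ ?_ ?_ ?_ ?_ a
  · refine isClosed_of_closure_subset fun a ha => ?_
    change Filter.Tendsto _ _ _
    rw [Metric.tendsto_nhds]
    intro ε hε
    obtain ⟨b, hb, hab⟩ := Metric.mem_closure_iff.1 ha (ε / 3) (by positivity)
    filter_upwards [Metric.tendsto_nhds.1 (show Filter.Tendsto _ _ _ from hb) (ε / 3)
      (by positivity)] with t ht
    have h1 : dist (∑ v ∈ t, p E v * a) (∑ v ∈ t, p E v * b) ≤ dist a b := by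
      rw [dist_eq_norm, dist_eq_norm, ← Finset.sum_sub_distrib]
      simp only [← mul_sub]
      exact norm_sum_p_mul_le (j := fun v => v) Function.injective_id t (a - b)
    have h2 := dist_triangle4 (∑ v ∈ t, p E v * a) (∑ v ∈ t, p E v * b) b a
    rw [dist_comm b a] at h2
    linarith
  · simp
  · intro a b ha hb
    simpa only [mul_add] using ha.add hb
  · intro c a ha
    simpa only [mul_smul_comm] using ha.const_smul c
  · intro a b ha _
    simpa only [mul_assoc] using ha.mul_right b
  · exact fun e => hsingle (E.r e) _ ((family E).P_mul_S e)
  · exact fun e => hsingle (E.s e) _ ((family E).P_mul_star_S e)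
  · exact fun v => hsingle v _ ((family E).P_mul_self v)

theorem summable_p_mul {ι : Type v} {j : ι → E.Vertex} (hj : Function.Injective j)
    (a : GraphCStarAlgebra E) : Summable fun i => p E (j i) * a :=
  (hasSum_p_mul a).summable.comp_injective hj

theorem hasSum_mul_p {ι : Type v} {j : ι → E.Vertex} (hj : Function.Injective j)
    (a : GraphCStarAlgebra E) :
    HasSum (fun i => a * p E (j i)) (star (∑' i, p E (j i) * star a)) := by
  have h := (summable_p_mul hj (star a)).hasSum.star
  simpa only [star_mul, star_star, (family E).star_P] using h

theorem norm_tsum_p_mul_le {ι : Type v} {j : ι → E.Vertex} (hj : Function.Injective j)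
    (a : GraphCStarAlgebra E) : ‖∑' i, p E (j i) * a‖ ≤ ‖a‖ :=
  le_of_tendsto (summable_p_mul hj a).hasSum.norm
    (Filter.Eventually.of_forall fun t => norm_sum_p_mul_le hj t a)

/-- The multiplier `∑ i, p_{j(i)}` of `C⋆(E)`, for a family of distinct vertices `j(i)`. -/
noncomputable def vertexSum {ι : Type v} {j : ι → E.Vertex} (hj : Function.Injective j) :
    𝓜(ℂ, GraphCStarAlgebra E) where
  fst := LinearMap.mkContinuous
    { toFun := fun a => ∑' i, p E (j i) * a
      map_add' := fun a b => by
        simp only [mul_add]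
        exact (summable_p_mul hj a).tsum_add (summable_p_mul hj b)
      map_smul' := fun c a => by
        simp only [mul_smul_comm]
        exact (summable_p_mul hj a).tsum_const_smul c } 1
    (fun a => by rw [one_mul]; exact norm_tsum_p_mul_le hj a)
  snd := LinearMap.mkContinuous
    { toFun := fun a => star (∑' i, p E (j i) * star a)
      map_add' := fun a b => by
        refine (hasSum_mul_p hj (a + b)).unique ?_
        simpa only [add_mul] using (hasSum_mul_p hj a).add (hasSum_mul_p hj b)
      map_smul' := fun c a => by
        refine (hasSum_mul_p hj (c • a)).unique ?_
        simp only [smul_mul_assoc]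
        exact (hasSum_mul_p hj a).const_smul c } 1
    (fun a => by
      rw [one_mul, ← norm_star a]
      change ‖star _‖ ≤ _
      rw [norm_star]
      exact norm_tsum_p_mul_le hj _)
  central := fun x y => by
    refine ((hasSum_mul_p hj x).mul_right y).unique ?_
    simp only [mul_assoc]
    exact (summable_p_mul hj y).hasSum.mul_left x

variable {ι : Type v} {j : ι → E.Vertex} (hj : Function.Injective j)

theorem isStrictSum_vertexSum :
    DoubleCentralizer.IsStrictSum (fun i => p E (j i)) (vertexSum hj) := fun a =>
  ⟨(summable_p_mul hj a).hasSum, hasSum_mul_p hj a⟩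

theorem vertexSum_snd (a : GraphCStarAlgebra E) :
    (vertexSum hj).snd a = star ((vertexSum hj).fst (star a)) := rfl

/-- The multiplier fixes an element that lives at one of its vertices. -/
theorem vertexSum_fst_of_mem {v : E.Vertex} (hv : v ∈ Set.range j) {a : GraphCStarAlgebra E}
    (ha : p E v * a = a) : (vertexSum hj).fst a = a := by
  obtain ⟨i, rfl⟩ := hv
  refine (isStrictSum_vertexSum hj a).1.unique ?_
  have := hasSum_single (f := fun k => p E (j k) * a) i fun k hk => by
    rw [← ha, ← mul_assoc, (family E).orthogonal_P _ _ (hj.ne hk), zero_mul]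
  rwa [ha] at this

theorem vertexSum_fst_of_notMem {v : E.Vertex} (hv : v ∉ Set.range j) {a : GraphCStarAlgebra E}
    (ha : p E v * a = a) : (vertexSum hj).fst a = 0 := by
  refine (isStrictSum_vertexSum hj a).1.unique ?_
  convert hasSum_zero using 2 with i
  rw [← ha, ← mul_assoc, (family E).orthogonal_P _ _ (fun h => hv ⟨i, h⟩), zero_mul]

theorem vertexSum_snd_of_mem {v : E.Vertex} (hv : v ∈ Set.range j) {a : GraphCStarAlgebra E}
    (ha : a * p E v = a) : (vertexSum hj).snd a = a := by
  rw [vertexSum_snd, vertexSum_fst_of_mem hj hv, star_star]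
  rw [← star_p, ← star_mul, ha]

theorem vertexSum_snd_of_notMem {v : E.Vertex} (hv : v ∉ Set.range j) {a : GraphCStarAlgebra E}
    (ha : a * p E v = a) : (vertexSum hj).snd a = 0 := by
  rw [vertexSum_snd, vertexSum_fst_of_notMem hj hv, star_zero]
  rw [← star_p, ← star_mul, ha]

end multipliers

end GraphCStarAlgebra

/-- A multiplier is determined by its left action. -/
theorem DoubleCentralizer.ext_fst {A : Type w} [NonUnitalCStarAlgebra A] {P Q : 𝓜(ℂ, A)}
    (h : ∀ a, P.fst a = Q.fst a) : P = Q := by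
  refine DoubleCentralizer.ext ℂ A P Q (Prod.ext (ContinuousLinearMap.ext h)
    (ContinuousLinearMap.ext fun x => eq_of_mul_right_eq fun y => ?_))
  rw [P.central, Q.central, h]

namespace GraphCStarAlgebra

section multipliers

variable {E : DirectedGraph.{u}} [E.RowFinite]
variable {ι : Type v} {j : ι → E.Vertex} (hj : Function.Injective j)

theorem isStarProjection_vertexSum : IsStarProjection (vertexSum hj) where
  isIdempotentElem := DoubleCentralizer.ext_fst fun a => by
    rw [DoubleCentralizer.mul_fst, mul_apply_eq_comp]
    refine (((isStrictSum_vertexSum hj a).1.mapL (vertexSum hj).fst).unique ?_)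
    convert (isStrictSum_vertexSum hj a).1 using 2 with i
    refine vertexSum_fst_of_mem hj ⟨i, rfl⟩ ?_
    rw [← mul_assoc, (family E).P_mul_self]
  isSelfAdjoint := DoubleCentralizer.ext_fst fun a => by
    rw [DoubleCentralizer.star_fst, vertexSum_snd, star_star, star_star]

theorem vertexSum_add_vertexSum {κ : Type w} {k : κ → E.Vertex} (hk : Function.Injective k)
    (h : IsCompl (Set.range j) (Set.range k)) : vertexSum hj + vertexSum hk = 1 :=
  DoubleCentralizer.ext_fst fun a => by
    rw [DoubleCentralizer.add_fst, DoubleCentralizer.one_fst]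
    refine HasSum.unique ?_ (hasSum_p_mul a)
    refine HasSum.add_isCompl h ?_ ?_
    · exact (hj.hasSum_range_iff (f := fun v => p E v * a)).2 (isStrictSum_vertexSum hj a).1
    · exact (hk.hasSum_range_iff (f := fun v => p E v * a)).2 (isStrictSum_vertexSum hk a).1

/-- A multiplier `P` of `C⋆(E)` is full as soon as every vertex projection is a limit of sums of
products `a P b`, since these limits form a right ideal and the vertex projections sum strictly
to the identity. -/
theorem isFull_of_forall_p_mem {P : 𝓜(ℂ, GraphCStarAlgebra E)}
    (h : ∀ v, p E v ∈ Submodule.span ℂ {x | ∃ a b : GraphCStarAlgebra E, x = a * P.fst b}) :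
    P.IsFull := by
  rw [DoubleCentralizer.IsFull, eq_top_iff]
  intro a _
  refine mem_closure_of_tendsto (show Filter.Tendsto _ _ _ from hasSum_p_mul a)
    (Filter.Eventually.of_forall fun t => Submodule.sum_mem _ fun v _ => ?_)
  have hmap : Submodule.map (LinearMap.mulRight ℂ a)
      (Submodule.span ℂ {x | ∃ a b : GraphCStarAlgebra E, x = a * P.fst b}) ≤
      Submodule.span ℂ {x | ∃ a b : GraphCStarAlgebra E, x = a * P.fst b} := by
    rw [Submodule.map_span, Submodule.span_le]
    rintro _ ⟨_, ⟨b, c, rfl⟩, rfl⟩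
    refine Submodule.subset_span ⟨b, c * a, ?_⟩
    rw [LinearMap.mulRight_apply, DoubleCentralizer.fst_mul_right, mul_assoc]
  exact hmap ⟨_, h v, rfl⟩

end multipliers

end GraphCStarAlgebra

/-! ### Elementary strong shift equivalences -/

theorem mul_star_mul_self_of_star_mul {A : Type*} [NonUnitalSemiring A] [Star A] {a q : A}
    (h : star a * a = q) (ha : a * q = a) : a * star a * a = a := by
  rw [mul_assoc, h, ha]

namespace DirectedGraph.ElementarySSE

variable {E₁ E₂ E₃ : DirectedGraph.{u}} (h : ElementarySSE E₁ E₂ E₃)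

/-- The relation of elementary strong shift equivalence is symmetric. -/
def symm : ElementarySSE E₂ E₁ E₃ where
  ι₁ := h.ι₂
  ι₂ := h.ι₁
  ι₁_injective := h.ι₂_injective
  ι₂_injective := h.ι₁_injective
  vertex_union := by rw [Set.union_comm, h.vertex_union]
  vertex_disjoint := h.vertex_disjoint.symm
  edge_bipartite η := (h.edge_bipartite η).symm
  θ₁ := h.θ₂
  θ₁_range := h.θ₂_range
  θ₁_source := h.θ₂_source
  θ₂ := h.θ₁
  θ₂_range := h.θ₁_range
  θ₂_source := h.θ₁_source
  source_condition := h.source_condition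

theorem isCompl_range : IsCompl (Set.range h.ι₁) (Set.range h.ι₂) :=
  ⟨h.vertex_disjoint, codisjoint_iff.2 h.vertex_union⟩

theorem r_mem_iff (η : E₃.Edge) : E₃.r η ∈ Set.range h.ι₁ ↔ E₃.s η ∉ Set.range h.ι₁ := by
  have hd : ∀ v, v ∈ Set.range h.ι₁ → v ∉ Set.range h.ι₂ :=
    fun v h1 h2 => Set.disjoint_left.1 h.vertex_disjoint h1 h2
  rcases h.edge_bipartite η with ⟨h1, h2⟩ | ⟨h1, h2⟩
  · exact ⟨fun h3 => absurd h2 (hd _ h3), fun h3 => absurd h1 h3⟩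
  · exact ⟨fun _ h4 => hd _ h4 h1, fun _ => h2⟩

theorem s_ne_r (h : ElementarySSE E₁ E₂ E₃) (η : E₃.Edge) : E₃.s η ≠ E₃.r η := fun hη => by
  have := h.r_mem_iff η
  rw [hη] at this
  tauto

/-- An edge that leaves a source is the only one to do so, and the only one at its range. -/
theorem eq_of_isSource (h : ElementarySSE E₁ E₂ E₃) {η ξ : E₃.Edge} (hη : E₃.IsSource (E₃.s η))
    (hξ : E₃.s ξ = E₃.s η ∨ E₃.r ξ = E₃.r η) : ξ = η := by
  obtain ⟨ζ, h1, h2⟩ := h.source_condition _ hη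
  have hηζ : η = ζ := h1.subset (Set.mem_ofPred_eq ▸ rfl : η ∈ {ξ | E₃.s ξ = E₃.s η})
  subst hηζ
  rcases hξ with hξ | hξ
  · exact h1.subset hξ
  · exact h2.subset hξ

theorem exists_edge {η ξ : E₃.Edge} (hηξ : E₃.s η = E₃.r ξ) (hη : E₃.r η ∈ Set.range h.ι₁) :
    ∃ e, (h.θ₁ e).1 = (η, ξ) := by
  have hξ : E₃.s ξ ∈ Set.range h.ι₁ := by
    by_contra hξ
    exact (h.r_mem_iff η).1 hη (hηξ ▸ (h.r_mem_iff ξ).2 hξ)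
  exact ⟨h.θ₁.symm ⟨(η, ξ), hηξ, hξ, hη⟩, congrArg Subtype.val (h.θ₁.apply_symm_apply _)⟩

/-- The first letter of the path of length two that corresponds to an edge of `E₁`. -/
abbrev fstEdge (e : E₁.Edge) : E₃.Edge := (h.θ₁ e).1.1

/-- The second letter of the path of length two that corresponds to an edge of `E₁`. -/
abbrev sndEdge (e : E₁.Edge) : E₃.Edge := (h.θ₁ e).1.2

theorem s_fstEdge (e : E₁.Edge) : E₃.s (h.fstEdge e) = E₃.r (h.sndEdge e) := (h.θ₁ e).2.1

theorem s_fstEdge_notMem (e : E₁.Edge) : E₃.s (h.fstEdge e) ∉ Set.range h.ι₁ :=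
  (h.r_mem_iff _).1 (h.θ₁ e).2.2.2

theorem eq_of_fstEdge_of_sndEdge {e f : E₁.Edge} (h1 : h.fstEdge e = h.fstEdge f)
    (h2 : h.sndEdge e = h.sndEdge f) : e = f :=
  h.θ₁.injective (Subtype.ext (Prod.ext h1 h2))

variable [E₁.RowFinite] [E₃.RowFinite]

/-- A sum over the paths of length two into a vertex of `E₁` is a sum over edges of `E₁`. -/
theorem sum_edgesInto {M : Type v} [AddCommMonoid M] (f : E₃.Edge → E₃.Edge → M) (v : E₁.Vertex) :
    ∑ η ∈ E₃.edgesInto (h.ι₁ v), ∑ ξ ∈ E₃.edgesInto (E₃.s η), f η ξ =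
      ∑ e ∈ E₁.edgesInto v, f (h.fstEdge e) (h.sndEdge e) := by
  rw [Finset.sum_sigma']
  symm
  refine Finset.sum_bij (fun e _ => ⟨h.fstEdge e, h.sndEdge e⟩) ?_ ?_ ?_ ?_
  · intro e he
    rw [mem_edgesInto] at he
    rw [Finset.mem_sigma, mem_edgesInto, mem_edgesInto]
    exact ⟨by rw [h.θ₁_range, he], (h.s_fstEdge e).symm⟩
  · intro e _ f _ hef
    rw [Sigma.mk.injEq] at hef
    exact h.eq_of_fstEdge_of_sndEdge hef.1 (eq_of_heq hef.2)
  · rintro ⟨η, ξ⟩ hηξ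
    rw [Finset.mem_sigma, mem_edgesInto, mem_edgesInto] at hηξ
    obtain ⟨e, he⟩ := h.exists_edge hηξ.2.symm ⟨v, hηξ.1.symm⟩
    have h1 : h.fstEdge e = η := congrArg Prod.fst he
    have h2 : h.sndEdge e = ξ := congrArg Prod.snd he
    refine ⟨e, ?_, ?_⟩
    · rw [mem_edgesInto]
      apply h.ι₁_injective
      rw [← h.θ₁_range, ← hηξ.1]
      exact congrArg _ h1
    · simp only [h1, h2]
  · intro e _
    rfl

end DirectedGraph.ElementarySSE

/-! ### Contraction of families along paths of length two -/

namespace CuntzKriegerFamily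

open DirectedGraph

variable {E₁ E₂ E₃ : DirectedGraph.{u}} (h : ElementarySSE E₁ E₂ E₃)
variable {B : Type v} [NonUnitalCStarAlgebra B]

section contraction

variable [E₃.RowFinite]

/-- If a vertex of `E₁` is not a source, then no edge of `E₃` into it starts at a source, and its
projection is a sum of range projections of paths of length two. -/
theorem P_eq_sum_sum (G : CuntzKriegerFamily E₃ B) {v : E₁.Vertex} (hv : ¬ E₁.IsSource v) :
    G.P (h.ι₁ v) = ∑ η ∈ E₃.edgesInto (h.ι₁ v), ∑ ξ ∈ E₃.edgesInto (E₃.s η),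
      (G.S η * G.S ξ) * star (G.S η * G.S ξ) := by
  obtain ⟨e, he⟩ := Set.nonempty_iff_ne_empty.2 hv
  have he : E₃.r (h.fstEdge e) = h.ι₁ v := by rw [h.θ₁_range, he]
  rw [G.ck2 _ (he ▸ not_isSource_r _)]
  refine Finset.sum_congr rfl fun η hη => ?_
  rw [mem_edgesInto] at hη
  have hs : ¬ E₃.IsSource (E₃.s η) := by
    intro hs
    have := h.eq_of_isSource hs (Or.inr (he.trans hη.symm))
    rw [← this, h.s_fstEdge] at hs
    exact not_isSource_r _ hs
  trans G.S η * G.P (E₃.s η) * star (G.S η)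
  · rw [G.S_mul_P]
  · rw [G.ck2 _ hs, Finset.mul_sum, Finset.sum_mul]
    simp only [star_mul, mul_assoc]

variable [E₁.RowFinite]

/-- A Cuntz–Krieger `E₃`-family gives a Cuntz–Krieger `E₁`-family by `S_e = T_η T_ξ`, where `ηξ` is
the path of length two that corresponds to `e`. -/
def contract (G : CuntzKriegerFamily E₃ B) : CuntzKriegerFamily E₁ B where
  S e := G.S (h.fstEdge e) * G.S (h.sndEdge e)
  P v := G.P (h.ι₁ v)
  isStarProjection_P v := G.isStarProjection_P _
  orthogonal_P v w hvw := G.orthogonal_P _ _ (h.ι₁_injective.ne hvw)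
  partialIsometry_S e := by
    refine mul_star_mul_self_of_star_mul (q := G.P (E₃.s (h.sndEdge e))) ?_ ?_
    · rw [star_mul, mul_assoc, ← mul_assoc (star (G.S (h.fstEdge e))), G.ck1, h.s_fstEdge,
        G.P_mul_S, G.ck1]
    · rw [mul_assoc, G.S_mul_P]
  orthogonal_S e f hef := by
    rw [star_mul, mul_assoc, ← mul_assoc (star (G.S (h.fstEdge e)))]
    by_cases h1 : h.fstEdge e = h.fstEdge f
    · rw [← h1, G.ck1, h1, h.s_fstEdge, G.P_mul_S, G.orthogonal_S]
      exact fun h2 => hef (h.eq_of_fstEdge_of_sndEdge h1 h2)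
    · rw [G.orthogonal_S _ _ h1, zero_mul, mul_zero]
  ck1 e := by
    rw [star_mul, mul_assoc, ← mul_assoc (star (G.S (h.fstEdge e))), G.ck1, h.s_fstEdge,
        G.P_mul_S, G.ck1, h.θ₁_source]
  ck2 v hv := by
    rw [G.P_eq_sum_sum h hv,
      h.sum_edgesInto (fun η ξ => (G.S η * G.S ξ) * star (G.S η * G.S ξ)) v]

end contraction

/-! ### Expansion of families over matrix units -/

section columns

variable [E₃.RowFinite]

open Classical in
/-- The columns that make up the projection of a vertex `w` outside `E₁`: one for each edge into
`w`, and one for the edge that leaves `w` if `w` is a source. -/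
noncomputable def columns (w : E₃.Vertex) : Finset E₃.Edge :=
  if hw : E₃.IsSource w then {(h.source_condition w hw).choose} else E₃.edgesInto w

theorem mem_columns {w : E₃.Vertex} {j : E₃.Edge} :
    j ∈ columns h w ↔ (E₃.IsSource w ∧ E₃.s j = w) ∨ E₃.r j = w := by
  by_cases hw : E₃.IsSource w
  · have hsp := (h.source_condition w hw).choose_spec.1
    have hr : E₃.r j ≠ w := fun hj => not_isSource_r j (hj ▸ hw)
    rw [columns, dif_pos hw, Finset.mem_singleton]
    simp only [hw, hr, true_and, or_false]
    exact (Set.ext_iff.1 hsp j).symm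
  · rw [columns, dif_neg hw, mem_edgesInto]
    tauto

theorem columns_of_not_isSource {w : E₃.Vertex} (hw : ¬ E₃.IsSource w) :
    columns h w = E₃.edgesInto w := dif_neg hw

end columns

section expansion

variable [E₁.RowFinite] {A : Type w} [NonUnitalCStarAlgebra A] (F : CuntzKriegerFamily E₁ A)

open Classical in
/-- The projections of a family of `E₁`, indexed by the vertices of `E₃`; they are `0` outside
`E₁`. -/
noncomputable def extP (v : E₃.Vertex) : A :=
  if hv : v ∈ Set.range h.ι₁ then F.P hv.choose else 0

open Classical in
/-- The partial isometries of a family of `E₁`, indexed by pairs of edges of `E₃`; they are `0` for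
pairs that do not form a path between vertices of `E₁`. -/
noncomputable def extS (η ξ : E₃.Edge) : A :=
  if hq : E₃.s η = E₃.r ξ ∧ E₃.s ξ ∈ Set.range h.ι₁ ∧ E₃.r η ∈ Set.range h.ι₁ then
    F.S (h.θ₁.symm ⟨(η, ξ), hq⟩) else 0

theorem extP_ι (v : E₁.Vertex) : F.extP h (h.ι₁ v) = F.P v := by
  have hv : h.ι₁ v ∈ Set.range h.ι₁ := ⟨v, rfl⟩
  rw [extP, dif_pos hv, h.ι₁_injective hv.choose_spec]

theorem extP_of_notMem {v : E₃.Vertex} (hv : v ∉ Set.range h.ι₁) : F.extP h v = 0 :=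
  dif_neg hv

theorem extS_θ (e : E₁.Edge) : F.extS h (h.fstEdge e) (h.sndEdge e) = F.S e := by
  rw [extS, dif_pos (h.θ₁ e).2]
  exact congrArg F.S (h.θ₁.symm_apply_apply e)

theorem extP_mul_self (v : E₃.Vertex) : F.extP h v * F.extP h v = F.extP h v := by
  by_cases hv : v ∈ Set.range h.ι₁
  · obtain ⟨v, rfl⟩ := hv
    rw [extP_ι, F.P_mul_self]
  · rw [F.extP_of_notMem h hv, mul_zero]

theorem star_extP (v : E₃.Vertex) : star (F.extP h v) = F.extP h v := by
  by_cases hv : v ∈ Set.range h.ι₁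
  · obtain ⟨v, rfl⟩ := hv
    rw [extP_ι, F.star_P]
  · rw [F.extP_of_notMem h hv, star_zero]

theorem extP_mul_extP_of_ne {v w : E₃.Vertex} (hvw : v ≠ w) : F.extP h v * F.extP h w = 0 := by
  by_cases hv : v ∈ Set.range h.ι₁
  · by_cases hw : w ∈ Set.range h.ι₁
    · obtain ⟨v, rfl⟩ := hv
      obtain ⟨w, rfl⟩ := hw
      rw [extP_ι, extP_ι, F.orthogonal_P _ _ fun hh => hvw (congrArg h.ι₁ hh)]
    · rw [F.extP_of_notMem h hw, mul_zero]
  · rw [F.extP_of_notMem h hv, zero_mul]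

theorem extP_mul_extS_of_ne {v : E₃.Vertex} {η ξ : E₃.Edge} (hv : v ≠ E₃.r η)
    (hηξ : E₃.s η = E₃.r ξ) (hη : E₃.r η ∈ Set.range h.ι₁) : F.extP h v * F.extS h η ξ = 0 := by
  obtain ⟨e, he⟩ := h.exists_edge hηξ hη
  obtain ⟨rfl, rfl⟩ := Prod.ext_iff.1 he
  rw [h.θ₁_range] at hv
  by_cases hv' : v ∈ Set.range h.ι₁
  · obtain ⟨v, rfl⟩ := hv'
    rw [extP_ι, extS_θ, F.P_mul_S_of_ne fun hh => hv (congrArg h.ι₁ hh)]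
  · rw [F.extP_of_notMem h hv', zero_mul]

theorem star_extS_mul_extS {η ξ : E₃.Edge} (hηξ : E₃.s η = E₃.r ξ)
    (hη : E₃.r η ∈ Set.range h.ι₁) :
    star (F.extS h η ξ) * F.extS h η ξ = F.extP h (E₃.s ξ) := by
  obtain ⟨e, he⟩ := h.exists_edge hηξ hη
  obtain ⟨rfl, rfl⟩ := Prod.ext_iff.1 he
  rw [extS_θ, F.ck1, h.θ₁_source, extP_ι]

theorem star_extS_mul_extS_of_ne {η ξ η' ξ' : E₃.Edge} (hηξ : E₃.s η = E₃.r ξ)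
    (hη : E₃.r η ∈ Set.range h.ι₁) (hηξ' : E₃.s η' = E₃.r ξ') (hη' : E₃.r η' ∈ Set.range h.ι₁)
    (hne : ¬ (η = η' ∧ ξ = ξ')) : star (F.extS h η ξ) * F.extS h η' ξ' = 0 := by
  obtain ⟨e, he⟩ := h.exists_edge hηξ hη
  obtain ⟨rfl, rfl⟩ := Prod.ext_iff.1 he
  obtain ⟨f, hf⟩ := h.exists_edge hηξ' hη'
  obtain ⟨rfl, rfl⟩ := Prod.ext_iff.1 hf
  rw [extS_θ, extS_θ, F.orthogonal_S]
  rintro rfl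
  exact hne ⟨rfl, rfl⟩

open Classical in
/-- The projection in column `j`, at the vertex of `E₁` that `j` touches. -/
noncomputable def columnProj (j : E₃.Edge) : A :=
  if E₃.s j ∈ Set.range h.ι₁ then F.extP h (E₃.s j) else F.extP h (E₃.r j)

open Classical in
/-- The entry in column `j` of the operator of an edge `η` with range in `E₁`. -/
noncomputable def columnEntry (η j : E₃.Edge) : A :=
  if η = j then F.extP h (E₃.r η) else F.extS h η j

theorem columnProj_mul_self (j : E₃.Edge) :
    F.columnProj h j * F.columnProj h j = F.columnProj h j := by
  unfold columnProj
  split_ifs <;> exact F.extP_mul_self h _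

theorem star_columnProj (j : E₃.Edge) : star (F.columnProj h j) = F.columnProj h j := by
  unfold columnProj
  split_ifs <;> exact F.star_extP h _

variable [E₃.RowFinite]

theorem columnEntry_cases {η j : E₃.Edge} (hη : E₃.r η ∈ Set.range h.ι₁)
    (hj : j ∈ columns h (E₃.s η)) :
    (j = η ∧ E₃.IsSource (E₃.s η) ∧ F.columnEntry h η j = F.extP h (E₃.r η) ∧
      F.columnProj h j = F.extP h (E₃.r η)) ∨
    (E₃.s η = E₃.r j ∧ F.columnEntry h η j = F.extS h η j ∧
      F.columnProj h j = F.extP h (E₃.s j)) := by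
  rcases (mem_columns h).1 hj with ⟨h1, h2⟩ | h1
  · left
    obtain rfl := h.eq_of_isSource h1 (Or.inl h2)
    exact ⟨rfl, h1, if_pos rfl, if_neg ((h.r_mem_iff _).1 hη)⟩
  · right
    refine ⟨h1.symm, if_neg ?_, if_pos ?_⟩
    · rintro rfl
      exact h.s_ne_r _ h1.symm
    · by_contra h2
      rw [← h.r_mem_iff, h1] at h2
      exact (h.r_mem_iff _).1 hη h2

theorem star_columnEntry_mul_columnEntry {η j : E₃.Edge} (hη : E₃.r η ∈ Set.range h.ι₁)
    (hj : j ∈ columns h (E₃.s η)) :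
    star (F.columnEntry h η j) * F.columnEntry h η j = F.columnProj h j := by
  rcases F.columnEntry_cases h hη hj with ⟨_, _, h1, h2⟩ | ⟨h0, h1, h2⟩
  · rw [h1, h2, F.star_extP, F.extP_mul_self]
  · rw [h1, h2, F.star_extS_mul_extS h h0 hη]

theorem star_columnEntry_mul_columnEntry_of_ne {η j η' j' : E₃.Edge}
    (hη : E₃.r η ∈ Set.range h.ι₁) (hj : j ∈ columns h (E₃.s η))
    (hη' : E₃.r η' ∈ Set.range h.ι₁) (hj' : j' ∈ columns h (E₃.s η'))
    (hne : ¬ (η = η' ∧ j = j')) :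
    star (F.columnEntry h η j) * F.columnEntry h η' j' = 0 := by
  rcases F.columnEntry_cases h hη hj with ⟨rfl, hs, h1, -⟩ | ⟨h0, h1, -⟩ <;>
  rcases F.columnEntry_cases h hη' hj' with ⟨rfl, hs', h1', -⟩ | ⟨h0', h1', -⟩ <;>
  rw [h1, h1']
  · rw [F.star_extP, F.extP_mul_extP_of_ne]
    exact fun hr => hne ⟨h.eq_of_isSource hs' (Or.inr hr), h.eq_of_isSource hs' (Or.inr hr)⟩
  · rw [F.star_extP, F.extP_mul_extS_of_ne h _ h0' hη']
    intro hr
    obtain rfl := h.eq_of_isSource hs (Or.inr hr.symm)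
    exact not_isSource_r _ (h0' ▸ hs)
  · rw [← F.star_extP, ← star_mul, F.extP_mul_extS_of_ne h _ h0 hη, star_zero]
    intro hr
    obtain rfl := h.eq_of_isSource hs' (Or.inr hr.symm)
    exact not_isSource_r _ (h0 ▸ hs')
  · exact F.star_extS_mul_extS_of_ne h h0 hη h0' hη' hne

/-- At a vertex of `E₁` that receives an edge of `E₃`, the entries of the edges into it satisfy the
second Cuntz–Krieger relation. -/
theorem sum_columnEntry_mul_star {v : E₃.Vertex} (hv : v ∈ Set.range h.ι₁)
    (hv' : ¬ E₃.IsSource v) :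
    F.extP h v = ∑ η ∈ E₃.edgesInto v, ∑ j ∈ columns h (E₃.s η),
      F.columnEntry h η j * star (F.columnEntry h η j) := by
  by_cases hs : ∃ η, E₃.r η = v ∧ E₃.IsSource (E₃.s η)
  · obtain ⟨η, rfl, hs⟩ := hs
    have h1 : E₃.edgesInto (E₃.r η) = {η} := by
      ext ξ
      rw [mem_edgesInto, Finset.mem_singleton]
      exact ⟨fun hr => h.eq_of_isSource hs (Or.inr hr), fun hr => hr ▸ rfl⟩
    have h2 : columns h (E₃.s η) = {η} := by
      ext ξ
      rw [mem_columns, Finset.mem_singleton]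
      constructor
      · rintro (⟨_, h3⟩ | h3)
        · exact h.eq_of_isSource hs (Or.inl h3)
        · exact absurd hs (h3 ▸ not_isSource_r ξ)
      · rintro rfl
        exact Or.inl ⟨hs, rfl⟩
    rw [h1, Finset.sum_singleton, h2, Finset.sum_singleton, columnEntry, if_pos rfl, F.star_extP,
      F.extP_mul_self]
  · push Not at hs
    obtain ⟨v, rfl⟩ := hv
    obtain ⟨η, hη⟩ := Set.nonempty_iff_ne_empty.2 hv'
    obtain ⟨ξ, hξ⟩ := Set.nonempty_iff_ne_empty.2 (hs η hη)
    obtain ⟨e, he⟩ := h.exists_edge (show E₃.s η = E₃.r ξ from hξ.symm) ⟨v, hη.symm⟩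
    have hv1 : ¬ E₁.IsSource v := by
      have : E₁.r e = v := by
        apply h.ι₁_injective
        rw [← h.θ₁_range, he]
        exact hη
      exact this ▸ not_isSource_r e
    rw [extP_ι, F.ck2 v hv1]
    trans ∑ η ∈ E₃.edgesInto (h.ι₁ v), ∑ j ∈ E₃.edgesInto (E₃.s η),
      F.extS h η j * star (F.extS h η j)
    · rw [h.sum_edgesInto (fun η j => F.extS h η j * star (F.extS h η j))]
      simp only [extS_θ]
    · refine Finset.sum_congr rfl fun η hη => ?_
      rw [mem_edgesInto] at hη
      rw [columns_of_not_isSource h (hs η hη)]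
      refine Finset.sum_congr rfl fun j hj => ?_
      rw [mem_edgesInto] at hj
      have : η ≠ j := by
        rintro rfl
        exact h.s_ne_r _ hj.symm
      rw [columnEntry, if_neg this]

variable (m : MatrixUnits (Option E₃.Edge) A B)

open Classical in
/-- The projections of the expanded family. -/
noncomputable def expandP (v : E₃.Vertex) : B :=
  if v ∈ Set.range h.ι₁ then m.unit none none (F.extP h v)
  else ∑ j ∈ columns h v, m.unit (some j) (some j) (F.columnProj h j)

open Classical in
/-- The partial isometries of the expanded family. -/
noncomputable def expandS (η : E₃.Edge) : B :=
  if E₃.s η ∈ Set.range h.ι₁ then m.unit (some η) none (F.extP h (E₃.s η))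
  else ∑ j ∈ columns h (E₃.s η), m.unit none (some j) (F.columnEntry h η j)

theorem expandP_of_mem {v : E₃.Vertex} (hv : v ∈ Set.range h.ι₁) :
    F.expandP h m v = m.unit none none (F.extP h v) := if_pos hv

theorem expandP_of_notMem {v : E₃.Vertex} (hv : v ∉ Set.range h.ι₁) :
    F.expandP h m v = ∑ j ∈ columns h v, m.unit (some j) (some j) (F.columnProj h j) := if_neg hv

theorem expandS_of_mem {η : E₃.Edge} (hη : E₃.s η ∈ Set.range h.ι₁) :
    F.expandS h m η = m.unit (some η) none (F.extP h (E₃.s η)) := if_pos hη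

theorem expandS_of_notMem {η : E₃.Edge} (hη : E₃.s η ∉ Set.range h.ι₁) :
    F.expandS h m η = ∑ j ∈ columns h (E₃.s η), m.unit none (some j) (F.columnEntry h η j) :=
  if_neg hη

theorem isStarProjection_expandP (v : E₃.Vertex) : IsStarProjection (F.expandP h m v) := by
  classical
  by_cases hv : v ∈ Set.range h.ι₁
  · rw [F.expandP_of_mem h m hv]
    exact ⟨by rw [IsIdempotentElem, m.unit_mul_unit, F.extP_mul_self],
      by rw [IsSelfAdjoint, m.star_unit, F.star_extP]⟩
  · rw [F.expandP_of_notMem h m hv]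
    constructor
    · rw [IsIdempotentElem, Finset.sum_mul_sum]
      refine Finset.sum_congr rfl fun j hj => ?_
      rw [Finset.sum_eq_single_of_mem j hj fun k _ hk =>
        m.unit_mul_unit_of_ne _ _ _ _ _ _ fun hh => hk (Option.some_injective _ hh).symm,
        m.unit_mul_unit, F.columnProj_mul_self]
    · rw [IsSelfAdjoint, star_sum]
      refine Finset.sum_congr rfl fun j _ => ?_
      rw [m.star_unit, F.star_columnProj]

theorem expandP_mul_expandP_of_ne (v w : E₃.Vertex) (hvw : v ≠ w) :
    F.expandP h m v * F.expandP h m w = 0 := by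
  by_cases hv : v ∈ Set.range h.ι₁ <;> by_cases hw : w ∈ Set.range h.ι₁
  · rw [F.expandP_of_mem h m hv, F.expandP_of_mem h m hw, m.unit_mul_unit,
      F.extP_mul_extP_of_ne h hvw, map_zero]
  · rw [F.expandP_of_mem h m hv, F.expandP_of_notMem h m hw, Finset.mul_sum]
    exact Finset.sum_eq_zero fun j _ => m.unit_mul_unit_of_ne _ _ _ _ _ _ (by simp)
  · rw [F.expandP_of_notMem h m hv, F.expandP_of_mem h m hw, Finset.sum_mul]
    exact Finset.sum_eq_zero fun j _ => m.unit_mul_unit_of_ne _ _ _ _ _ _ (by simp)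
  · rw [F.expandP_of_notMem h m hv, F.expandP_of_notMem h m hw, Finset.sum_mul_sum]
    refine Finset.sum_eq_zero fun j hj => Finset.sum_eq_zero fun k hk =>
      m.unit_mul_unit_of_ne _ _ _ _ _ _ fun hh => ?_
    obtain rfl := Option.some_injective _ hh
    rw [mem_columns] at hj hk
    have hr := h.r_mem_iff j
    rcases hj with ⟨_, rfl⟩ | rfl <;> rcases hk with ⟨_, rfl⟩ | rfl <;> tauto

theorem star_expandS_mul_expandS (η : E₃.Edge) :
    star (F.expandS h m η) * F.expandS h m η = F.expandP h m (E₃.s η) := by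
  classical
  by_cases hη : E₃.s η ∈ Set.range h.ι₁
  · rw [F.expandS_of_mem h m hη, F.expandP_of_mem h m hη, m.star_unit, m.unit_mul_unit,
      F.star_extP, F.extP_mul_self]
  · have hr := (h.r_mem_iff η).2 hη
    rw [F.expandS_of_notMem h m hη, F.expandP_of_notMem h m hη, star_sum, Finset.sum_mul_sum]
    refine Finset.sum_congr rfl fun j hj => ?_
    simp only [m.star_unit, m.unit_mul_unit]
    rw [Finset.sum_eq_single_of_mem j hj, F.star_columnEntry_mul_columnEntry h hr hj]
    intro k hk hkj
    rw [F.star_columnEntry_mul_columnEntry_of_ne h hr hj hr hk fun hh => hkj hh.2.symm, map_zero]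

theorem star_expandS_mul_expandS_of_ne (η ζ : E₃.Edge) (hne : η ≠ ζ) :
    star (F.expandS h m η) * F.expandS h m ζ = 0 := by
  by_cases hη : E₃.s η ∈ Set.range h.ι₁ <;> by_cases hζ : E₃.s ζ ∈ Set.range h.ι₁
  · rw [F.expandS_of_mem h m hη, F.expandS_of_mem h m hζ, m.star_unit]
    exact m.unit_mul_unit_of_ne _ _ _ _ _ _ fun hh => hne (Option.some_injective _ hh)
  · rw [F.expandS_of_mem h m hη, F.expandS_of_notMem h m hζ, m.star_unit, Finset.mul_sum]
    exact Finset.sum_eq_zero fun j _ => m.unit_mul_unit_of_ne _ _ _ _ _ _ (by simp)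
  · rw [F.expandS_of_notMem h m hη, F.expandS_of_mem h m hζ, star_sum, Finset.sum_mul]
    refine Finset.sum_eq_zero fun j _ => ?_
    rw [m.star_unit]
    exact m.unit_mul_unit_of_ne _ _ _ _ _ _ (by simp)
  · rw [F.expandS_of_notMem h m hη, F.expandS_of_notMem h m hζ, star_sum, Finset.sum_mul_sum]
    refine Finset.sum_eq_zero fun j hj => Finset.sum_eq_zero fun k hk => ?_
    rw [m.star_unit, m.unit_mul_unit, F.star_columnEntry_mul_columnEntry_of_ne h
      ((h.r_mem_iff η).2 hη) hj ((h.r_mem_iff ζ).2 hζ) hk fun hh => hne hh.1, map_zero]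

theorem expandP_eq_sum (v : E₃.Vertex) (hv : ¬ E₃.IsSource v) :
    F.expandP h m v = ∑ η ∈ E₃.edgesInto v, F.expandS h m η * star (F.expandS h m η) := by
  classical
  by_cases hv1 : v ∈ Set.range h.ι₁
  · rw [F.expandP_of_mem h m hv1, F.sum_columnEntry_mul_star h hv1 hv, map_sum]
    refine Finset.sum_congr rfl fun η hη => ?_
    rw [mem_edgesInto] at hη
    rw [F.expandS_of_notMem h m ((h.r_mem_iff η).1 (hη ▸ hv1)), map_sum, star_sum,
      Finset.sum_mul_sum]
    refine Finset.sum_congr rfl fun j hj => ?_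
    rw [Finset.sum_eq_single_of_mem j hj, m.star_unit, m.unit_mul_unit]
    intro k _ hk
    rw [m.star_unit]
    exact m.unit_mul_unit_of_ne _ _ _ _ _ _ fun hh => hk (Option.some_injective _ hh).symm
  · rw [F.expandP_of_notMem h m hv1, columns_of_not_isSource h hv]
    refine Finset.sum_congr rfl fun η hη => ?_
    rw [mem_edgesInto] at hη
    have hs : E₃.s η ∈ Set.range h.ι₁ := by
      by_contra hs
      exact hv1 (hη ▸ (h.r_mem_iff η).2 hs)
    rw [F.expandS_of_mem h m hs, m.star_unit, m.unit_mul_unit, F.star_extP, F.extP_mul_self,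
      columnProj, if_pos hs]

theorem expandS_mul_expandP (η : E₃.Edge) :
    F.expandS h m η * F.expandP h m (E₃.s η) = F.expandS h m η := by
  have h1 := F.star_expandS_mul_expandS h m η
  have h2 := (F.isStarProjection_expandP h m (E₃.s η))
  have h3 := h2.isIdempotentElem.eq
  have h4 := h2.isSelfAdjoint.star_eq
  -- `(TQ - T)⋆(TQ - T) = 0` for an operator `T` with `T⋆T = Q` a projection
  rw [← sub_eq_zero, ← CStarRing.star_mul_self_eq_zero_iff, star_sub, star_mul, h4, sub_mul,
    mul_sub, mul_sub, h1, ← mul_assoc, mul_assoc _ (star _), h1, mul_assoc, ← mul_assoc (star _),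
    h1, h3, h3]
  simp

/-- A Cuntz–Krieger `E₁`-family expands to a Cuntz–Krieger `E₃`-family over matrix units that are
indexed by the edges of `E₃` and one more index, for the vertices of `E₁`. -/
noncomputable def expand : CuntzKriegerFamily E₃ B where
  S := F.expandS h m
  P := F.expandP h m
  isStarProjection_P := F.isStarProjection_expandP h m
  orthogonal_P := F.expandP_mul_expandP_of_ne h m
  partialIsometry_S η :=
    mul_star_mul_self_of_star_mul (F.star_expandS_mul_expandS h m η) (F.expandS_mul_expandP h m η)
  orthogonal_S := F.star_expandS_mul_expandS_of_ne h m
  ck1 := F.star_expandS_mul_expandS h m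
  ck2 := F.expandP_eq_sum h m

theorem contract_expand_P (v : E₁.Vertex) :
    ((F.expand h m).contract h).P v = m.unit none none (F.P v) := by
  change F.expandP h m (h.ι₁ v) = _
  rw [F.expandP_of_mem h m ⟨v, rfl⟩, extP_ι]

theorem contract_expand_S (e : E₁.Edge) :
    ((F.expand h m).contract h).S e = m.unit none none (F.S e) := by
  classical
  change F.expandS h m (h.fstEdge e) * F.expandS h m (h.sndEdge e) = _
  have hmem : h.sndEdge e ∈ columns h (E₃.s (h.fstEdge e)) :=
    (mem_columns h).2 (Or.inr (h.s_fstEdge e).symm)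
  have hne : h.fstEdge e ≠ h.sndEdge e := fun hh => by
    have := h.s_fstEdge e
    rw [hh] at this
    exact h.s_ne_r _ this
  rw [F.expandS_of_notMem h m (h.s_fstEdge_notMem e), F.expandS_of_mem h m (h.θ₁ e).2.2.1,
    Finset.sum_mul, Finset.sum_eq_single_of_mem _ hmem fun k _ hk =>
      m.unit_mul_unit_of_ne _ _ _ _ _ _ fun hh => hk (Option.some_injective _ hh),
    m.unit_mul_unit, columnEntry, if_neg hne, extS_θ, h.θ₁_source, extP_ι, F.S_mul_P]

end expansion

end CuntzKriegerFamily

/-! ### The embedding as a corner -/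

namespace GraphCStarAlgebra

open DirectedGraph

variable {E₁ E₂ E₃ : DirectedGraph.{u}} (h : ElementarySSE E₁ E₂ E₃)

section fullness

variable [E₃.RowFinite]

/-- The range projection of an edge that leaves a source is the projection of its range. -/
theorem s_mul_star_s_of_isSource (h : ElementarySSE E₁ E₂ E₃) {η : E₃.Edge}
    (hη : E₃.IsSource (E₃.s η)) :
    s E₃ η * star (s E₃ η) = p E₃ (E₃.r η) := by
  have h1 : E₃.edgesInto (E₃.r η) = {η} := by
    ext ξ
    rw [mem_edgesInto, Finset.mem_singleton]
    exact ⟨fun hr => h.eq_of_isSource hη (Or.inr hr), fun hr => hr ▸ rfl⟩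
  rw [p, (family E₃).ck2 _ (not_isSource_r η), h1, Finset.sum_singleton]

/-- The multiplier projection of the vertices of `E₁` is full: any other vertex projection is a
sum of range projections of edges from `E₁` or, at a source, the initial projection of an edge
into `E₁`. -/
theorem isFull_vertexSum : (vertexSum h.ι₁_injective).IsFull := by
  refine isFull_of_forall_p_mem fun v => ?_
  by_cases hv : v ∈ Set.range h.ι₁
  · refine Submodule.subset_span ⟨p E₃ v, p E₃ v, ?_⟩
    rw [vertexSum_fst_of_mem h.ι₁_injective hv ((family E₃).P_mul_self v),
      (family E₃).P_mul_self]
  · by_cases hs : E₃.IsSource v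
    · obtain ⟨η, hη, -⟩ := h.source_condition v hs
      have hηv : E₃.s η = v := hη.symm.subset rfl
      refine Submodule.subset_span ⟨star (s E₃ η), s E₃ η, ?_⟩
      rw [vertexSum_fst_of_mem h.ι₁_injective ((h.r_mem_iff η).2 (hηv ▸ hv))
        ((family E₃).P_mul_S η), (family E₃).ck1, hηv]
    · rw [p, (family E₃).ck2 v hs]
      refine Submodule.sum_mem _ fun η hη => Submodule.subset_span
        ⟨s E₃ η, star (s E₃ η), ?_⟩
      have hη' : E₃.s η ∈ Set.range h.ι₁ := by
        by_contra hc
        rw [mem_edgesInto] at hη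
        exact hv (hη ▸ (h.r_mem_iff η).2 hc)
      rw [vertexSum_fst_of_mem h.ι₁_injective hη' ((family E₃).P_mul_star_S η)]

end fullness

variable [E₁.RowFinite] [E₃.RowFinite]

/-- The ⋆-homomorphism `C⋆(E₁) → C⋆(E₃)` with `s_e ↦ s_η s_ξ`, where `ηξ` is the path of length two
that corresponds to `e`. -/
noncomputable def cornerHom : GraphCStarAlgebra E₁ →⋆ₙₐ[ℂ] GraphCStarAlgebra E₃ :=
  lift ((family E₃).contract h)

theorem cornerHom_s (e : E₁.Edge) :
    cornerHom h (s E₁ e) = s E₃ (h.fstEdge e) * s E₃ (h.sndEdge e) :=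
  lift_s _ e

theorem cornerHom_p (v : E₁.Vertex) : cornerHom h (p E₁ v) = p E₃ (h.ι₁ v) :=
  lift_p _ v

/-- The embedding is injective: the expansion of the canonical family of `E₁` over matrix units
turns it into the inclusion of `C⋆(E₁)` in a diagonal position. -/
theorem cornerHom_injective : Function.Injective (cornerHom h) := by
  rw [injective_iff_map_eq_zero]
  intro a ha
  by_contra ha0
  obtain ⟨B, _, m, hm⟩ := exists_matrixUnits (Option E₃.Edge) ha0
  have hcomp : (lift ((family E₁).expand h m)).comp (cornerHom h) = m.diag none := by
    refine hom_ext (fun e => ?_) fun v => ?_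
    · rw [NonUnitalStarAlgHom.comp_apply, cornerHom_s, map_mul, lift_s, lift_s]
      exact (family E₁).contract_expand_S h m e
    · rw [NonUnitalStarAlgHom.comp_apply, cornerHom_p, lift_p]
      exact (family E₁).contract_expand_P h m v
  apply hm none
  have h1 : m.diag none a = 0 := by
    rw [← hcomp, NonUnitalStarAlgHom.comp_apply, ha, map_zero]
  exact h1

theorem isClosedEmbedding_cornerHom : Topology.IsClosedEmbedding (cornerHom h) :=
  (AddMonoidHomClass.isometry_of_norm (cornerHom h)
    (NonUnitalStarAlgHom.norm_map (cornerHom h) (cornerHom_injective h))).isClosedEmbedding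

theorem cornerHom_fst (a : GraphCStarAlgebra E₁) :
    (vertexSum h.ι₁_injective).fst (cornerHom h a) = cornerHom h a := by
  have hc := (isClosedEmbedding_cornerHom h).continuous
  refine dense_induction (q := fun a => (vertexSum h.ι₁_injective).fst (cornerHom h a) =
    cornerHom h a) ?_ ?_ ?_ ?_ ?_ ?_ ?_ ?_ a
  · exact isClosed_eq ((vertexSum h.ι₁_injective).fst.continuous.comp hc) hc
  · simp only [map_zero]
  · intro a b ha hb
    rw [map_add, map_add, ha, hb]
  · intro c a ha
    rw [map_smul, map_smul, ha]
  · intro a b ha _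
    rw [map_mul, DoubleCentralizer.fst_mul_right, ha]
  · intro e
    rw [cornerHom_s]
    refine vertexSum_fst_of_mem _ (h.θ₁ e).2.2.2 ?_
    rw [← mul_assoc, (family E₃).P_mul_S]
  · intro e
    rw [map_star, cornerHom_s, star_mul]
    refine vertexSum_fst_of_mem _ (h.θ₁ e).2.2.1 ?_
    rw [← mul_assoc, (family E₃).P_mul_star_S]
  · intro v
    rw [cornerHom_p]
    exact vertexSum_fst_of_mem _ ⟨v, rfl⟩ ((family E₃).P_mul_self _)

theorem cornerHom_snd (a : GraphCStarAlgebra E₁) :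
    (vertexSum h.ι₁_injective).snd (cornerHom h a) = cornerHom h a := by
  rw [vertexSum_snd, ← map_star (cornerHom h), cornerHom_fst, map_star, star_star]

theorem cornerHom_mem_corner (a : GraphCStarAlgebra E₁) :
    cornerHom h a ∈
      (vertexSum h.ι₁_injective).corner (isStarProjection_vertexSum h.ι₁_injective) :=
  (DoubleCentralizer.mem_range_compress_iff _ (isStarProjection_vertexSum _) _).2
    ⟨cornerHom_fst h a, cornerHom_snd h a⟩

theorem s_mul_s_mem_range {η ξ : E₃.Edge} (hηξ : E₃.s η = E₃.r ξ)
    (hη : E₃.r η ∈ Set.range h.ι₁) :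
    s E₃ η * s E₃ ξ ∈ NonUnitalStarAlgHom.range (cornerHom h) := by
  obtain ⟨e, he⟩ := h.exists_edge hηξ hη
  obtain ⟨rfl, rfl⟩ := Prod.ext_iff.1 he
  exact ⟨s E₁ e, cornerHom_s h e⟩

theorem p_mem_range {v : E₃.Vertex} (hv : v ∈ Set.range h.ι₁) :
    p E₃ v ∈ NonUnitalStarAlgHom.range (cornerHom h) := by
  obtain ⟨v, rfl⟩ := hv
  exact ⟨p E₁ v, cornerHom_p h v⟩

/-- The elements `k` of `C⋆(E₃)` that correspond to the indices of the expanded family, the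
projections `p_v` together to the index of `E₁`. They have range in the corner at `E₁`, and the
projections `k⋆k` of distinct `k` sum strictly to the identity, so that an element `x` may be seen
as the column of its entries `k x`. -/
inductive IsRow : GraphCStarAlgebra E₃ → Prop
  | vertex {v : E₃.Vertex} (hv : v ∈ Set.range h.ι₁) : IsRow (p E₃ v)
  | star_edge {ξ : E₃.Edge} (hξ : E₃.s ξ ∈ Set.range h.ι₁) : IsRow (star (s E₃ ξ))
  | edge {η : E₃.Edge} (hη : E₃.IsSource (E₃.s η)) (hη' : E₃.r η ∈ Set.range h.ι₁) :
      IsRow (s E₃ η)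

theorem s_mul_mem_range {x : GraphCStarAlgebra E₃}
    (hx : ∀ k, IsRow h k → k * x ∈ NonUnitalStarAlgHom.range (cornerHom h)) {η : E₃.Edge}
    (hη : E₃.r η ∈ Set.range h.ι₁) : s E₃ η * x ∈ NonUnitalStarAlgHom.range (cornerHom h) := by
  by_cases hs : E₃.IsSource (E₃.s η)
  · exact hx _ (.edge hs hη)
  · have h1 : s E₃ η * x = ∑ ξ ∈ E₃.edgesInto (E₃.s η),
        (s E₃ η * s E₃ ξ) * (star (s E₃ ξ) * x) := by
      trans s E₃ η * p E₃ (E₃.s η) * x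
      · rw [s, p, (family E₃).S_mul_P]
      · rw [p, (family E₃).ck2 _ hs, Finset.mul_sum, Finset.sum_mul]
        simp only [mul_assoc]
    rw [h1]
    refine sum_mem fun ξ hξ => ?_
    rw [mem_edgesInto] at hξ
    refine mul_mem (s_mul_s_mem_range h hξ.symm hη) (hx _ (.star_edge ?_))
    by_contra hc
    exact (h.r_mem_iff η).1 hη (hξ ▸ (h.r_mem_iff ξ).2 hc)

/-- The elements whose entries lie in the range of the embedding form a left ideal. -/
theorem row_mul_mul_mem_range (a : GraphCStarAlgebra E₃) :
    ∀ x, (∀ k, IsRow h k → k * x ∈ NonUnitalStarAlgHom.range (cornerHom h)) →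
      ∀ k, IsRow h k → k * (a * x) ∈ NonUnitalStarAlgHom.range (cornerHom h) := by
  have hR : IsClosed (NonUnitalStarAlgHom.range (cornerHom h) : Set (GraphCStarAlgebra E₃)) :=
    (isClosedEmbedding_cornerHom h).isClosed_range
  refine dense_induction (q := fun a => ∀ x, (∀ k, IsRow h k → k * x ∈
    NonUnitalStarAlgHom.range (cornerHom h)) → ∀ k, IsRow h k → k * (a * x) ∈
      NonUnitalStarAlgHom.range (cornerHom h)) ?_ ?_ ?_ ?_ ?_ ?_ ?_ ?_ a
  · simp only [Set.ofPred_forall]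
    exact isClosed_iInter fun x => isClosed_iInter fun _ => isClosed_iInter fun k =>
      isClosed_iInter fun _ => hR.preimage
        (continuous_const.mul (continuous_id.mul continuous_const))
  · intro x _ k _
    rw [zero_mul, mul_zero]
    exact zero_mem _
  · intro a b ha hb x hx k hk
    rw [add_mul, mul_add]
    exact add_mem (ha x hx k hk) (hb x hx k hk)
  · intro c a ha x hx k hk
    rw [smul_mul_assoc, mul_smul_comm]
    exact SMulMemClass.smul_mem c (ha x hx k hk)
  · intro a b ha hb x hx k hk
    rw [mul_assoc]
    exact ha _ (hb x hx) k hk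
  · intro e x hx k hk
    rw [← mul_assoc]
    cases hk with
    | @vertex v hv =>
      by_cases hve : v = E₃.r e
      · subst hve
        rw [p, s, (family E₃).P_mul_S]
        exact s_mul_mem_range h hx hv
      · rw [p, s, (family E₃).P_mul_S_of_ne hve, zero_mul]
        exact zero_mem _
    | @star_edge ξ hξ =>
      by_cases hξe : ξ = e
      · subst hξe
        rw [s, (family E₃).ck1]
        exact hx _ (.vertex hξ)
      · rw [s, s, (family E₃).orthogonal_S _ _ hξe, zero_mul]
        exact zero_mem _
    | @edge η hη hη' =>
      have hne : E₃.s η ≠ E₃.r e := fun hh => not_isSource_r e (hh ▸ hη)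
      rw [s, s, (family E₃).S_mul_S_of_ne hne, zero_mul]
      exact zero_mem _
  · intro e x hx k hk
    rw [← mul_assoc]
    cases hk with
    | @vertex v hv =>
      by_cases hve : E₃.s e = v
      · subst hve
        rw [p, s, (family E₃).P_mul_star_S]
        exact hx _ (.star_edge hv)
      · rw [p, s, (family E₃).P_mul_star_S_of_ne hve, zero_mul]
        exact zero_mem _
    | @star_edge ξ hξ =>
      rw [← star_mul]
      by_cases hξe : E₃.s e = E₃.r ξ
      · have hre : E₃.r e ∈ Set.range h.ι₁ := by
          rw [h.r_mem_iff, hξe, h.r_mem_iff]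
          exact not_not.2 hξ
        have h1 : star (s E₃ e * s E₃ ξ) * x =
            star (s E₃ e * s E₃ ξ) * (p E₃ (E₃.r e) * x) := by
          rw [star_mul, ← mul_assoc _ (p E₃ (E₃.r e)), mul_assoc (star (s E₃ ξ)) _ (p E₃ _)]
          rw [p, s, s, (family E₃).star_S_mul_P]
        rw [h1]
        exact mul_mem (star_mem (s_mul_s_mem_range h hξe hre)) (hx _ (.vertex hre))
      · rw [s, s, (family E₃).S_mul_S_of_ne hξe, star_zero, zero_mul]
        exact zero_mem _
    | @edge η hη hη' =>
      by_cases hηe : E₃.s e = E₃.s η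
      · obtain rfl := h.eq_of_isSource hη (Or.inl hηe)
        rw [s_mul_star_s_of_isSource h hη]
        exact hx _ (.vertex hη')
      · rw [s, s, (family E₃).S_mul_star_S_of_ne (Ne.symm hηe), zero_mul]
        exact zero_mem _
  · intro w x hx k hk
    rw [← mul_assoc]
    cases hk with
    | @vertex v hv =>
      by_cases hvw : v = w
      · subst hvw
        rw [p, (family E₃).P_mul_self]
        exact hx _ (.vertex hv)
      · rw [p, p, (family E₃).orthogonal_P _ _ hvw, zero_mul]
        exact zero_mem _
    | @star_edge ξ hξ =>
      by_cases hw : w = E₃.r ξ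
      · subst hw
        rw [p, s, (family E₃).star_S_mul_P]
        exact hx _ (.star_edge hξ)
      · rw [p, s, (family E₃).star_S_mul_P_of_ne hw, zero_mul]
        exact zero_mem _
    | @edge η hη hη' =>
      by_cases hw : E₃.s η = w
      · subst hw
        rw [p, s, (family E₃).S_mul_P]
        exact hx _ (.edge hη hη')
      · rw [p, s, (family E₃).S_mul_P_of_ne hw, zero_mul]
        exact zero_mem _

theorem p_mul_mul_p_mem_range {v w : E₃.Vertex} (hv : v ∈ Set.range h.ι₁)
    (hw : w ∈ Set.range h.ι₁) (a : GraphCStarAlgebra E₃) :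
    p E₃ v * (a * p E₃ w) ∈ NonUnitalStarAlgHom.range (cornerHom h) := by
  refine row_mul_mul_mem_range h a (p E₃ w) (fun k hk => ?_) _ (.vertex hv)
  cases hk with
  | @vertex u hu => exact mul_mem (p_mem_range h hu) (p_mem_range h hw)
  | @star_edge ξ hξ =>
    have hne : w ≠ E₃.r ξ := by
      rintro rfl
      exact (h.r_mem_iff ξ).1 hw hξ
    rw [p, s, (family E₃).star_S_mul_P_of_ne hne]
    exact zero_mem _
  | @edge η hη hη' =>
    have hne : E₃.s η ≠ w := by
      rintro rfl
      exact (h.r_mem_iff η).1 hη' hw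
    rw [p, s, (family E₃).S_mul_P_of_ne hne]
    exact zero_mem _

/-- The range of the embedding is the corner at the vertices of `E₁`. -/
theorem compress_mem_range (a : GraphCStarAlgebra E₃) :
    (vertexSum h.ι₁_injective).compress a ∈ NonUnitalStarAlgHom.range (cornerHom h) := by
  have hR : IsClosed (NonUnitalStarAlgHom.range (cornerHom h) : Set (GraphCStarAlgebra E₃)) :=
    (isClosedEmbedding_cornerHom h).isClosed_range
  have hP := isStrictSum_vertexSum h.ι₁_injective
  refine hR.mem_of_tendsto (show Filter.Tendsto _ _ _ from (hP _).1)
    (Filter.Eventually.of_forall fun t => sum_mem fun v _ => ?_)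
  refine hR.mem_of_tendsto
    (show Filter.Tendsto _ _ _ from (hP a).2.mul_left (p E₃ (h.ι₁ v)))
    (Filter.Eventually.of_forall fun t => sum_mem fun w _ => ?_)
  exact p_mul_mul_p_mem_range h ⟨v, rfl⟩ ⟨w, rfl⟩ a

/-- The isomorphism of `C⋆(E₁)` with the corner of `C⋆(E₃)` at the vertices of `E₁`. -/
noncomputable def cornerEquiv : GraphCStarAlgebra E₁ ≃⋆ₐ[ℂ]
    (vertexSum h.ι₁_injective).corner (isStarProjection_vertexSum h.ι₁_injective) :=
  StarAlgEquiv.ofBijective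
    (NonUnitalStarAlgHom.codRestrict (cornerHom h) _ (cornerHom_mem_corner h)) <| by
    constructor
    · intro a b hab
      exact cornerHom_injective h (congrArg Subtype.val hab)
    · rintro ⟨_, a, rfl⟩
      obtain ⟨b, hb⟩ := compress_mem_range h a
      exact ⟨b, Subtype.ext hb⟩

/-- The embedding intertwines the gauge action with every weighted gauge action for which the paths
of length two between vertices of `E₁` have weight one. -/
theorem cornerHom_gaugeAction {n : E₃.Edge → ℕ}
    (hn : ∀ e, n (h.fstEdge e) + n (h.sndEdge e) = 1) (z : Circle) (a : GraphCStarAlgebra E₁) :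
    cornerHom h ((gaugeAction E₁).hom z a) = (weightedGaugeAction E₃ n).hom z (cornerHom h a) := by
  have : (cornerHom h).comp ((gaugeAction E₁).hom z) =
      ((weightedGaugeAction E₃ n).hom z).comp (cornerHom h) := by
    refine hom_ext (fun e => ?_) fun v => ?_
    · rw [NonUnitalStarAlgHom.comp_apply, NonUnitalStarAlgHom.comp_apply, gaugeAction_s, map_smul,
        cornerHom_s, map_mul, weightedGaugeAction_s, weightedGaugeAction_s, smul_mul_smul_comm,
        ← Circle.coe_mul, ← pow_add, hn, pow_one]
    · rw [NonUnitalStarAlgHom.comp_apply, NonUnitalStarAlgHom.comp_apply, gaugeAction_p,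
        cornerHom_p, weightedGaugeAction_p]
  exact congrArg (fun φ => φ a) this

end GraphCStarAlgebra

/-! ### The diagonal subalgebras -/

namespace GraphCStarAlgebra

open DirectedGraph

section diagonal

variable (E : DirectedGraph.{u}) [E.RowFinite]

/-- The linear span of the range projections of the finite paths. -/
noncomputable def pathSpan : Submodule ℂ (GraphCStarAlgebra E) :=
  Submodule.span ℂ {x | ∃ (v w : E.Vertex) (μ : E.FinPath v w), x = (family E).rangeProj μ}

theorem pathSpan_le_diagonal {x : GraphCStarAlgebra E} (hx : x ∈ pathSpan E) :
    x ∈ diagonal E := by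
  have : pathSpan E ≤ (diagonal E).toSubmodule := by
    refine Submodule.span_le.2 ?_
    rintro x hx
    exact NonUnitalStarSubalgebra.le_topologicalClosure _
      (NonUnitalStarAlgebra.subset_adjoin ℂ _ hx)
  exact this hx

variable {E}

theorem rangeProj_mem_pathSpan {v w : E.Vertex} (μ : E.FinPath v w) :
    (family E).rangeProj μ ∈ pathSpan E :=
  Submodule.subset_span ⟨v, w, μ, rfl⟩

theorem s_mul_mul_star_s_mem_pathSpan (e : E.Edge) {x : GraphCStarAlgebra E}
    (hx : x ∈ pathSpan E) : s E e * x * star (s E e) ∈ pathSpan E := by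
  induction hx using Submodule.span_induction with
  | mem x hx =>
    obtain ⟨v, w, μ, rfl⟩ := hx
    by_cases hv : E.s e = v
    · subst hv
      exact (family E).rangeProj_cons e μ ▸ rangeProj_mem_pathSpan _
    · rw [← (family E).P_mul_rangeProj, ← mul_assoc, s, (family E).S_mul_P_of_ne hv, zero_mul,
        zero_mul]
      exact zero_mem _
  | zero => simp
  | add x y _ _ hx hy =>
    rw [mul_add, add_mul]
    exact add_mem hx hy
  | smul c x _ hx =>
    rw [mul_smul_comm, smul_mul_assoc]
    exact Submodule.smul_mem _ c hx

end diagonal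

variable {E₁ E₂ E₃ : DirectedGraph.{u}} (h : ElementarySSE E₁ E₂ E₃)
variable [E₁.RowFinite] [E₃.RowFinite]

theorem cornerHom_rangeProj_mem {v w : E₁.Vertex} (μ : E₁.FinPath v w) :
    cornerHom h ((family E₁).rangeProj μ) ∈ pathSpan E₃ := by
  induction μ with
  | vertex v =>
    rw [CuntzKriegerFamily.rangeProj_vertex, cornerHom_p, p,
      ← CuntzKriegerFamily.rangeProj_vertex]
    exact rangeProj_mem_pathSpan _
  | cons e μ ih =>
    have h1 : cornerHom h ((family E₁).rangeProj (.cons e μ)) =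
        s E₃ (h.fstEdge e) * (s E₃ (h.sndEdge e) * cornerHom h ((family E₁).rangeProj μ) *
          star (s E₃ (h.sndEdge e))) * star (s E₃ (h.fstEdge e)) := by
      rw [CuntzKriegerFamily.rangeProj_cons, map_mul, map_mul, map_star, cornerHom_s, star_mul]
      simp only [mul_assoc]
    rw [h1]
    exact s_mul_mul_star_s_mem_pathSpan _ (s_mul_mul_star_s_mem_pathSpan _ ih)

/-- Conjugation by a path of length two between vertices of `E₁`. -/
theorem s_mul_s_conj_mem_map {η ξ : E₃.Edge} (hηξ : E₃.s η = E₃.r ξ)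
    (hη : E₃.r η ∈ Set.range h.ι₁) {x : GraphCStarAlgebra E₃}
    (hx : x ∈ cornerHom h '' pathSpan E₁) :
    s E₃ η * (s E₃ ξ * x * star (s E₃ ξ)) * star (s E₃ η) ∈ cornerHom h '' pathSpan E₁ := by
  obtain ⟨e, he⟩ := h.exists_edge hηξ hη
  obtain ⟨rfl, rfl⟩ := Prod.ext_iff.1 he
  obtain ⟨y, hy, rfl⟩ := hx
  refine ⟨_, s_mul_mul_star_s_mem_pathSpan e hy, ?_⟩
  rw [map_mul, map_mul, map_star, cornerHom_s, star_mul]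
  simp only [mul_assoc]

theorem p_mem_image {v : E₃.Vertex} (hv : v ∈ Set.range h.ι₁) :
    p E₃ v ∈ cornerHom h '' pathSpan E₁ := by
  obtain ⟨v, rfl⟩ := hv
  refine ⟨p E₁ v, ?_, cornerHom_p h v⟩
  rw [p, ← CuntzKriegerFamily.rangeProj_vertex]
  exact rangeProj_mem_pathSpan _

/-- The range projection of a path of `E₃` that ends in `E₁` is a sum of images of range projections
of paths of `E₁`. The second half, on a path preceded by an edge into `E₁`, makes the induction
over the parity of the length work. -/
theorem rangeProj_mem_image {v w : E₃.Vertex} (μ : E₃.FinPath v w) :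
    (v ∈ Set.range h.ι₁ → (family E₃).rangeProj μ ∈ cornerHom h '' pathSpan E₁) ∧
    (∀ η, E₃.s η = v → E₃.r η ∈ Set.range h.ι₁ →
      s E₃ η * (family E₃).rangeProj μ * star (s E₃ η) ∈ cornerHom h '' pathSpan E₁) := by
  induction μ with
  | vertex v =>
    rw [CuntzKriegerFamily.rangeProj_vertex]
    refine ⟨fun hv => p_mem_image h hv, ?_⟩
    rintro η rfl hη
    by_cases hs : E₃.IsSource (E₃.s η)
    · rw [s, (family E₃).S_mul_P]
      exact (s_mul_star_s_of_isSource h hs).symm ▸ p_mem_image h hη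
    · rw [(family E₃).ck2 _ hs, Finset.mul_sum, Finset.sum_mul]
      change _ ∈ Submodule.map
        (cornerHom h : GraphCStarAlgebra E₁ →ₗ[ℂ] GraphCStarAlgebra E₃) (pathSpan E₁)
      refine sum_mem fun ξ hξ => ?_
      rw [mem_edgesInto] at hξ
      have hξ' : E₃.s ξ ∈ Set.range h.ι₁ := by
        by_contra hc
        exact (h.r_mem_iff η).1 hη (hξ ▸ (h.r_mem_iff ξ).2 hc)
      have := s_mul_s_conj_mem_map h hξ.symm hη (p_mem_image h hξ')
      rw [s, s, (family E₃).S_mul_P] at this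
      exact this
  | cons e μ ih =>
    rw [CuntzKriegerFamily.rangeProj_cons]
    refine ⟨fun hv => ih.2 e rfl hv, fun η hη hη' => s_mul_s_conj_mem_map h hη hη' (ih.1 ?_)⟩
    by_contra hc
    exact (h.r_mem_iff η).1 hη' (hη ▸ (h.r_mem_iff e).2 hc)

/-- The diagonal of `E₃` commutes with the projection at the vertices of `E₁`, which compresses it
into the image of the diagonal of `E₁`. -/
theorem fst_eq_snd_and_mem_of_mem_diagonal {d : GraphCStarAlgebra E₃} (hd : d ∈ diagonal E₃) :
    (vertexSum h.ι₁_injective).fst d = (vertexSum h.ι₁_injective).snd d ∧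
      (vertexSum h.ι₁_injective).fst d ∈ (diagonal E₁).map (cornerHom h) := by
  have hinj := h.ι₁_injective
  have hP := isStarProjection_vertexSum hinj
  have hff : ∀ a, (vertexSum hinj).fst ((vertexSum hinj).fst a) = (vertexSum hinj).fst a :=
    fun a => congrArg (fun Q : 𝓜(ℂ, GraphCStarAlgebra E₃) => Q.fst a) hP.isIdempotentElem.eq
  let T : NonUnitalStarSubalgebra ℂ (GraphCStarAlgebra E₃) :=
    { carrier := {d | (vertexSum hinj).fst d = (vertexSum hinj).snd d ∧
        (vertexSum hinj).fst d ∈ (diagonal E₁).map (cornerHom h)}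
      add_mem' := fun {a b} ha hb => by
        refine ⟨?_, ?_⟩
        · rw [map_add, map_add, ha.1, hb.1]
        · rw [map_add]
          exact add_mem ha.2 hb.2
      zero_mem' := by
        refine ⟨?_, ?_⟩
        · rw [map_zero, map_zero]
        · rw [map_zero]
          exact zero_mem _
      smul_mem' := fun c a ha => by
        refine ⟨?_, ?_⟩
        · rw [map_smul, map_smul, ha.1]
        · rw [map_smul]
          exact SMulMemClass.smul_mem c ha.2
      mul_mem' := fun {a b} ha hb => by
        refine ⟨?_, ?_⟩
        · rw [DoubleCentralizer.fst_mul_right, DoubleCentralizer.snd_mul_left, ha.1,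
            (vertexSum hinj).central, hb.1]
        · have : (vertexSum hinj).fst (a * b) =
              (vertexSum hinj).fst a * (vertexSum hinj).fst b := by
            rw [DoubleCentralizer.fst_mul_right, ha.1, (vertexSum hinj).central,
              (vertexSum hinj).central, hff]
          rw [this]
          exact mul_mem ha.2 hb.2
      star_mem' := fun {a} ha => by
        have h1 : (vertexSum hinj).fst (star a) = star ((vertexSum hinj).snd a) := by
          rw [vertexSum_snd, star_star]
        have h2 : (vertexSum hinj).snd (star a) = star ((vertexSum hinj).fst a) := by
          rw [vertexSum_snd, star_star]
        refine ⟨?_, ?_⟩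
        · rw [h1, h2, ha.1]
        · rw [h1, ← ha.1]
          exact star_mem ha.2 }
  have hcl : IsClosed (T : Set (GraphCStarAlgebra E₃)) := by
    refine IsClosed.inter (isClosed_eq (vertexSum hinj).fst.continuous
      (vertexSum hinj).snd.continuous) (IsClosed.preimage (vertexSum hinj).fst.continuous ?_)
    exact (isClosedEmbedding_cornerHom h).isClosedMap _
      (NonUnitalStarSubalgebra.isClosed_topologicalClosure _)
  have hle : diagonal E₃ ≤ T := by
    refine NonUnitalStarSubalgebra.topologicalClosure_minimal _
      (NonUnitalStarAlgebra.adjoin_le ?_) hcl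
    rintro _ ⟨v, w, μ, rfl⟩
    change (family E₃).rangeProj μ ∈ T
    have hl := (family E₃).P_mul_rangeProj μ
    have hr := (family E₃).rangeProj_mul_P μ
    by_cases hv : v ∈ Set.range h.ι₁
    · refine ⟨?_, ?_⟩
      · rw [vertexSum_fst_of_mem hinj hv hl, vertexSum_snd_of_mem hinj hv hr]
      · rw [vertexSum_fst_of_mem hinj hv hl]
        obtain ⟨x, hx, hx'⟩ := (rangeProj_mem_image h μ).1 hv
        exact ⟨x, pathSpan_le_diagonal E₁ hx, hx'⟩
    · refine ⟨?_, ?_⟩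
      · rw [vertexSum_fst_of_notMem hinj hv hl, vertexSum_snd_of_notMem hinj hv hr]
      · rw [vertexSum_fst_of_notMem hinj hv hl]
        exact zero_mem _
  exact hle hd

theorem cornerHom_mem_diagonal {a : GraphCStarAlgebra E₁} (ha : a ∈ diagonal E₁) :
    cornerHom h a ∈ diagonal E₃ := by
  have hle : diagonal E₁ ≤ (diagonal E₃).comap (cornerHom h) := by
    refine NonUnitalStarSubalgebra.topologicalClosure_minimal _
      (NonUnitalStarAlgebra.adjoin_le ?_) ?_
    · rintro _ ⟨v, w, μ, rfl⟩
      exact pathSpan_le_diagonal E₃ (cornerHom_rangeProj_mem h μ)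
    · exact (NonUnitalStarSubalgebra.isClosed_topologicalClosure _).preimage
        (isClosedEmbedding_cornerHom h).continuous
  exact hle ha

theorem image_diagonal_eq_image_fst :
    (fun a => (cornerEquiv h a : GraphCStarAlgebra E₃)) '' (diagonal E₁) =
      (fun c => (vertexSum h.ι₁_injective).fst c) '' (diagonal E₃) := by
  ext x
  constructor
  · rintro ⟨a, ha, rfl⟩
    exact ⟨_, cornerHom_mem_diagonal h ha, cornerHom_fst h a⟩
  · rintro ⟨d, hd, rfl⟩
    obtain ⟨a, ha, hax⟩ := (fst_eq_snd_and_mem_of_mem_diagonal h hd).2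
    exact ⟨a, ha, hax⟩

theorem image_diagonal_eq_image_compress :
    (fun a => (cornerEquiv h a : GraphCStarAlgebra E₃)) '' (diagonal E₁) =
      (vertexSum h.ι₁_injective).compress '' (diagonal E₃) := by
  rw [image_diagonal_eq_image_fst]
  refine Set.image_congr fun d hd => ?_
  have hP := isStarProjection_vertexSum h.ι₁_injective
  rw [DoubleCentralizer.compress, ← (fst_eq_snd_and_mem_of_mem_diagonal h hd).1]
  exact (congrArg (fun Q : 𝓜(ℂ, GraphCStarAlgebra E₃) => Q.fst d) hP.isIdempotentElem.eq).symm

end GraphCStarAlgebra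

open Classical in
/-- The weight of an edge of `E₃`: one if it ends in `E₁`, and zero if it ends in `E₂`. Each path of
length two between vertices of one of these graphs has one edge of either kind. -/
noncomputable def DirectedGraph.ElementarySSE.weight {E₁ E₂ E₃ : DirectedGraph.{u}}
    (h : ElementarySSE E₁ E₂ E₃) (η : E₃.Edge) : ℕ :=
  if E₃.r η ∈ Set.range h.ι₁ then 1 else 0

theorem DirectedGraph.ElementarySSE.weight_add_weight {E₁ E₂ E₃ : DirectedGraph.{u}}
    (h : ElementarySSE E₁ E₂ E₃) {η ξ : E₃.Edge} (hηξ : E₃.s η = E₃.r ξ) :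
    h.weight η + h.weight ξ = 1 := by
  have h1 := h.r_mem_iff η
  rw [hηξ] at h1
  unfold weight
  split_ifs <;> first | rfl | tauto

theorem mainTheorem1 (E₁ E₂ E₃ : DirectedGraph.{u}) [E₁.RowFinite] [E₂.RowFinite] [E₃.RowFinite]
    (h : DirectedGraph.ElementarySSE E₁ E₂ E₃) :
    (∃ (P₁ P₂ : 𝓜(ℂ, GraphCStarAlgebra E₃))
      (hP₁ : IsStarProjection P₁) (hP₂ : IsStarProjection P₂)
      (α : CircleAction (GraphCStarAlgebra E₃))
      (π₁ : GraphCStarAlgebra E₁ ≃⋆ₐ[ℂ] P₁.corner hP₁)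
      (π₂ : GraphCStarAlgebra E₂ ≃⋆ₐ[ℂ] P₂.corner hP₂),
      DoubleCentralizer.IsStrictSum (fun v : E₁.Vertex => GraphCStarAlgebra.p E₃ (h.ι₁ v)) P₁ ∧
      DoubleCentralizer.IsStrictSum (fun v : E₂.Vertex => GraphCStarAlgebra.p E₃ (h.ι₂ v)) P₂ ∧
      P₁ + P₂ = 1 ∧ P₁.IsFull ∧ P₂.IsFull ∧
      (∀ (z : Circle) (a : GraphCStarAlgebra E₁),
        (π₁ ((GraphCStarAlgebra.gaugeAction E₁).hom z a) : GraphCStarAlgebra E₃)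
          = α.hom z (π₁ a)) ∧
      (∀ (z : Circle) (a : GraphCStarAlgebra E₂),
        (π₂ ((GraphCStarAlgebra.gaugeAction E₂).hom z a) : GraphCStarAlgebra E₃)
          = α.hom z (π₂ a)) ∧
      (fun a => (π₁ a : GraphCStarAlgebra E₃)) ''
          (GraphCStarAlgebra.diagonal E₁ : Set (GraphCStarAlgebra E₁))
        = P₁.compress '' (GraphCStarAlgebra.diagonal E₃ : Set (GraphCStarAlgebra E₃)) ∧
      (fun a => (π₂ a : GraphCStarAlgebra E₃)) ''
          (GraphCStarAlgebra.diagonal E₂ : Set (GraphCStarAlgebra E₂))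
        = P₂.compress '' (GraphCStarAlgebra.diagonal E₃ : Set (GraphCStarAlgebra E₃))) ∧
    TripleMoritaEquivalent
      (GraphCStarAlgebra.gaugeAction E₁) (GraphCStarAlgebra.diagonal E₁)
      (GraphCStarAlgebra.gaugeAction E₂) (GraphCStarAlgebra.diagonal E₂) := by
  have hn₁ : ∀ e, h.weight (h.fstEdge e) + h.weight (h.sndEdge e) = 1 := fun e =>
    h.weight_add_weight (h.s_fstEdge e)
  have hn₂ : ∀ e, h.weight (h.symm.fstEdge e) + h.weight (h.symm.sndEdge e) = 1 := fun e =>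
    h.weight_add_weight (h.symm.s_fstEdge e)
  have hone := GraphCStarAlgebra.vertexSum_add_vertexSum h.ι₁_injective h.ι₂_injective
    h.isCompl_range
  refine ⟨⟨GraphCStarAlgebra.vertexSum h.ι₁_injective, GraphCStarAlgebra.vertexSum h.ι₂_injective,
    GraphCStarAlgebra.isStarProjection_vertexSum _, GraphCStarAlgebra.isStarProjection_vertexSum _,
    GraphCStarAlgebra.weightedGaugeAction E₃ h.weight, GraphCStarAlgebra.cornerEquiv h,
    GraphCStarAlgebra.cornerEquiv h.symm, GraphCStarAlgebra.isStrictSum_vertexSum _,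
    GraphCStarAlgebra.isStrictSum_vertexSum _, hone, GraphCStarAlgebra.isFull_vertexSum h,
    GraphCStarAlgebra.isFull_vertexSum h.symm, GraphCStarAlgebra.cornerHom_gaugeAction h hn₁,
    GraphCStarAlgebra.cornerHom_gaugeAction h.symm hn₂,
    GraphCStarAlgebra.image_diagonal_eq_image_compress h,
    GraphCStarAlgebra.image_diagonal_eq_image_compress h.symm⟩,
    GraphCStarAlgebra E₃, inferInstance, GraphCStarAlgebra.vertexSum h.ι₁_injective,
    GraphCStarAlgebra.vertexSum h.ι₂_injective,
    GraphCStarAlgebra.isStarProjection_vertexSum _, GraphCStarAlgebra.isStarProjection_vertexSum _,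
    GraphCStarAlgebra.weightedGaugeAction E₃ h.weight, GraphCStarAlgebra.diagonal E₃,
    GraphCStarAlgebra.cornerEquiv h, GraphCStarAlgebra.cornerEquiv h.symm,
    GraphCStarAlgebra.isFull_vertexSum h, GraphCStarAlgebra.isFull_vertexSum h.symm, hone,
    NonUnitalStarSubalgebra.isClosed_topologicalClosure _,
    GraphCStarAlgebra.cornerHom_gaugeAction h hn₁,
    GraphCStarAlgebra.cornerHom_gaugeAction h.symm hn₂,
    GraphCStarAlgebra.image_diagonal_eq_image_fst h,
    GraphCStarAlgebra.image_diagonal_eq_image_fst h.symm⟩
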